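/- Let $G$ be a group given by a presentation $P_G=\langle B\mid R\rangle$ (for instance a finite one), where the relators $r\in R$ are words in the letters $b^{\pm1}$, $b\in B$. Let $w_1,w_2$ be words in the letters $b^{\pm1}$ that represent the same element of $G$. Then any two circles with defects $[w_1]$ and $[w_2]$ (that is, any circle with defects reading $w_1$ and any circle with defects reading $w_2$) are cobordant in $\mathrm{Bord}_2^{\mathrm{def}}(\mathcal P_G)$: there is a bordism with defects from $[w_1]$ to $[w_2]$. Here the notions are as follows. *Circle with defects.* The standardly oriented unit circle $S^1\subset\mathbb C$ with distinguished point $-1$ and finitely many marked points in $S^1\setminus\{-1\}$, each labelled by a letter $b^{\pm1}$ (the complementary arcs carry the single region label $\ast$). It reads the word $w$ if the labels, read from $-1$ to $-1$ along the orientation, form $w$. *Surface with defects.* A smooth oriented surface $\Sigma$, possibly with boundary, decomposed as a disjoint union $\Sigma_0\sqcup\Sigma_1\sqcup\Sigma_2$ with $\Sigma_0$ and $\Sigma_0\cup\Sigma_1$ closed, where $\Sigma_0$ is a discrete set of interior points, $\Sigma_1$ is an oriented one-dimensional submanifold transversal to $\partial\Sigma$, and the decomposition is locally cone-like. The components of $\Sigma_1$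 are labelled by letters $b^{\pm1}$ (a label $x$ becomes $x^{-1}$ when read against the orientation), those of $\Sigma_2$ by $\ast$, and the points of $\Sigma_0$ by symbols $u_r^{\pm1}$ with $r\in R$. At a point labelled $u_r$ (respectively $u_r^{-1}$) the incident branches of $\Sigma_1$, taken counterclockwise and read towards the point, spell the word $r$ (respectively $r^{-1}$) up to cyclic permutation. *Bordism with defects from $U$ to $V$.* A compact surface with defects $\Sigma$ whose boundary is the disjoint union of the in-boundary $U$ and the out-boundary $V$. These come with collars, i.e. defect- and orientation-preserving open embeddings of $U\times[0,1)$ and $V\times(-1,0]$ into $\Sigma$. Here a cylinder $S^1\times J$ has the product orientation, its walls are the lines $\{\text{marked point}\}\times J$, and the label of such a wall, read in the direction of increasing $t\in J$, is the label of the marked point. Moreover $\Sigma$ has a Morse height function $f:\Sigma\to[0,1]$ with $f^{-1}(0)=U$, $f^{-1}(1)=V$ and no critical points on $\partial\Sigma$, and a choice of one distinguished point on each circle of each generic cross-section of $f$, such that all these points lie in one component of $\Sigma_2$ and those on $U$ and $V$ are the given distinguished points. A level set $f^{-1}(t)$ is a generic cross-section if for some $\varepsilon>0$ the set $f^{-1}((t-\varepsilon,t+\varepsilon))$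 is isomorphic, as a surface with defects, to an open cylinder or a collar on $f^{-1}(t)$. -/

import Mathlib

open scoped Manifold ContDiff Topology
open Set

/-! ## Defect conditions -/

/-- The set `X = D ∪ D̄` of elements of `D` and their formal inverses;
`(x, true)` is `x` and `(x, false)` is `x⁻¹`. -/
abbrev Signed (D : Type*) := D × Bool

/-- The formal inverse `x ^ ε ↦ x ^ (-ε)`. -/
def Signed.inv {D : Type*} (x : Signed D) : Signed D := (x.1, !x.2)

/-- Two-dimensional defect data. `Cycle (Signed D₁)` is the disjoint union over `m` of the quotients
of `(X₁)^m` by cyclic permutations. For `ψ₁₂ x = (α, β)`, the region `α` is on the left and the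
region `β` is on the right of a wall labelled `x`. -/
structure DefectData.{u} where
  D₂ : Type u
  D₁ : Type u
  D₀ : Type u
  ψ₁₂ : Signed D₁ → D₂ × D₂
  ψ₀₁ : Signed D₀ → Cycle (Signed D₁)
  ψ₁₂_inv : ∀ x, ψ₁₂ x.inv = (ψ₁₂ x).swap
  ψ₀₁_inv : ∀ u, ψ₀₁ u.inv = ((ψ₀₁ u).map Signed.inv).reverse
  /-- the cyclic words `ψ₀₁ u` are cyclically composable -/
  composable : ∀ u, (ψ₀₁ u).Chain (fun x y => (ψ₁₂ y).1 = (ψ₁₂ x).2)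

/-- The label set of a surface with defects: `X₀ ⊔ X₁ ⊔ D₂`. -/
inductive StratumLabel (D : DefectData)
  | vertex (u : Signed D.D₀)
  | wall (x : Signed D.D₁)
  | region (a : D.D₂)

/-- The dimension of the strata (in a surface) which carry a given label. -/
def StratumLabel.dim {D : DefectData} : StratumLabel D → ℕ
  | vertex _ => 0
  | wall _ => 1
  | region _ => 2

/-! ## Circles with defects -/

/-- A circle with defects. The underlying oriented circle is the unit circle in `ℂ` with its standard
orientation, and its distinguished point is `-1 = exp (iπ)`. Marked points are labelled by `X₁`, and
the points of the complementary arcs by `D₂`. -/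
structure DefectCircle (D : DefectData) where
  d : Circle → Signed D.D₁ ⊕ D.D₂
  finite_marked : {z | (d z).isLeft = true}.Finite
  base_unmarked : (d (Circle.exp Real.pi)).isRight = true
  const_on_arcs : ∀ z, ∀ w ∈ connectedComponentIn {z | (d z).isRight = true} z, d w = d z
  /-- The arc which comes in to a point labelled `x` carries the first component of `ψ₁₂ x`,
  and the arc which goes out carries the second one. -/
  compatible : ∀ z x, d z = Sum.inl x → ∀ᶠ s in 𝓝[>] (0 : ℝ),
    d (z * Circle.exp (-s)) = Sum.inr (D.ψ₁₂ x).1 ∧ d (z * Circle.exp s) = Sum.inr (D.ψ₁₂ x).2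

/-- `U.Represents w`: the labels of the marked points of `U`, read from `-1` to `-1` along the
standard orientation, form the word `w`. -/
def DefectCircle.Represents {D : DefectData} (U : DefectCircle D) (w : List (Signed D.D₁)) : Prop :=
  ∃ θ : Fin w.length → ℝ, StrictMono θ ∧ (∀ k, θ k ∈ Ioo (-Real.pi) Real.pi) ∧
    {z | (U.d z).isLeft = true} = range (fun k => Circle.exp (θ k)) ∧
    ∀ k, U.d (Circle.exp (θ k)) = Sum.inl (w.get k)

/-- The objects of the bordism category: finite (ordered) disjoint unions of circles with defects. -/
abbrev BordObject (D : DefectData) := List (DefectCircle D)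

/-! ## Oriented surfaces -/

/-- The plane. -/
abbrev Plane := EuclideanSpace ℝ (Fin 2)

/-- The model half-plane `{x | 0 ≤ x 0}`. -/
abbrev HalfPlane := EuclideanHalfSpace 2

/-- The determinant of two vectors of the plane. -/
def cross (u v : Plane) : ℝ := u 0 * v 1 - u 1 * v 0

section Surface

variable {M : Type} [TopologicalSpace M] [ChartedSpace HalfPlane M]

/-- The change of coordinates from `e` to `f` has a positive Jacobian determinant. -/
def OrientedCompatible (e f : OpenPartialHomeomorph M HalfPlane) : Prop :=
  ∀ q ∈ e.source ∩ f.source,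
    0 < (fderivWithin ℝ (f.extend (𝓡∂ 2) ∘ (e.extend (𝓡∂ 2)).symm) (range (𝓡∂ 2))
      (e.extend (𝓡∂ 2) q)).det

variable (M) in
/-- `M` is a smooth oriented surface with (possibly empty) boundary; the orientation is the one for
which all the charts of the given atlas are positive. -/
class OrientedSurface : Prop where
  smooth : IsManifold (𝓡∂ 2) ∞ M
  t2 : T2Space M
  second_countable : SecondCountableTopology M
  oriented : ∀ e ∈ atlas HalfPlane M, ∀ f ∈ atlas HalfPlane M, OrientedCompatible e f

/-- `e` is a smooth positively oriented chart of `M` (not necessarily in the given atlas). -/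
def IsOrientedChart (e : OpenPartialHomeomorph M HalfPlane) : Prop :=
  e ∈ IsManifold.maximalAtlas (𝓡∂ 2) ∞ M ∧ ∀ f ∈ atlas HalfPlane M, OrientedCompatible e f

/-! ## Surfaces with defects -/

/-- A wall has orientation `w` and label `y`; its label *read in the direction* `u` is `x`: either
`u` has the direction of `w` and `y = x`, or `u` has the opposite direction and `y = x⁻¹`. -/
def ReadsAlong {D₁ : Type*} (w u : Plane) (y x : Signed D₁) : Prop :=
  (∃ a : ℝ, 0 < a ∧ w = a • u ∧ y = x) ∨ (∃ a : ℝ, a < 0 ∧ w = a • u ∧ y = x.inv)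

/-- The image, in a chart `e`, of a tangent vector at `q`. -/
noncomputable def inChart (e : OpenPartialHomeomorph M HalfPlane) (q : M)
    (v : TangentSpace (𝓡∂ 2) q) : Plane :=
  mfderiv (𝓡∂ 2) (𝓡∂ 2) e q v

variable (M) in
/-- The structure of a surface with defects on an oriented surface `M`.

The decomposition `Σ₀, Σ₁, Σ₂` consists of the preimages under `d` of `X₀, X₁, D₂`. The orientation
of the one-dimensional strata ("walls") is given by tangent vectors `dir p`, for `p ∈ Σ₁`, which
matter only up to positive factors. -/
structure DefectStructure (D : DefectData) where
  d : M → StratumLabel D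
  dir : (p : M) → TangentSpace (𝓡∂ 2) p
  /-- admissibility of the decomposition -/
  closed_zero : IsClosed {p | (d p).dim = 0}
  closed_one : IsClosed {p | (d p).dim ≤ 1}
  /-- `d` is constant on the components of each `Σᵢ` -/
  const_on_strata : ∀ p, ∀ q ∈ connectedComponentIn {q | (d q).dim = (d p).dim} p, d q = d p
  /-- Every point `p` of `Σ₁` has a positively oriented chart in which `Σ₁` is the line through the
  image of `p` with direction `(1, 0)`; so `Σ₁` is a one-dimensional submanifold, transversal to the
  boundary, which is the line `{x | x 0 = 0}` in every chart. The label of the wall read in that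
  direction is `x`, and the regions on its left and right are labelled as `ψ₁₂ x` prescribes. -/
  wall_chart : ∀ p, (d p).dim = 1 →
    ∃ (e : OpenPartialHomeomorph M HalfPlane) (x : Signed D.D₁), IsOrientedChart e ∧ p ∈ e.source ∧
      ∀ q ∈ e.source,
        ((e q).1 1 = (e p).1 1 →
          ∃ y, d q = .wall y ∧ ReadsAlong (inChart e q (dir q)) !₂[1, 0] y x) ∧
        ((e p).1 1 < (e q).1 1 → d q = .region (D.ψ₁₂ x).1) ∧
        ((e q).1 1 < (e p).1 1 → d q = .region (D.ψ₁₂ x).2)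
  /-- `Σ₀` lies in the interior -/
  vertex_interior : ∀ p, (d p).dim = 0 → (𝓡∂ 2).IsInteriorPoint p
  /-- Every `p ∈ Σ₀` has a distinguished neighbourhood: a homeomorphism `h` onto an open subset of
  the plane, which is a positively oriented diffeomorphism off `p`, maps the walls to rays from the
  image of `p`. These rays, in counterclockwise order and read towards `p`, form the cyclic word
  prescribed by `ψ₀₁`. -/
  vertex_chart : ∀ p u, d p = .vertex u →
    ∃ (h : OpenPartialHomeomorph M HalfPlane) (w : List (Signed D.D₁)) (θ : Fin w.length → ℝ),
      p ∈ h.source ∧ IsOrientedChart (h.restr {p}ᶜ) ∧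
      D.ψ₀₁ u = (w : Cycle (Signed D.D₁)) ∧
      StrictMono θ ∧ (∀ k, θ k ∈ Ico 0 (2 * Real.pi)) ∧
      ∀ q ∈ h.source, q ≠ p →
        (((d q).dim = 1 ↔ ∃ k, ∃ r : ℝ, 0 < r ∧
          (h q).1 = (h p).1 + r • !₂[Real.cos (θ k), Real.sin (θ k)]) ∧
        ((d q).dim ≠ 1 → (d q).dim = 2) ∧
        ∀ k, ∀ r : ℝ, 0 < r → (h q).1 = (h p).1 + r • !₂[Real.cos (θ k), Real.sin (θ k)] →
          ∃ y, d q = .wall y ∧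
            ReadsAlong (inChart h q (dir q)) (-!₂[Real.cos (θ k), Real.sin (θ k)]) y (w.get k))

variable {D : DefectData}

/-! ## Cylinders, collars, bordisms -/

/-- An isomorphism of surfaces with defects from the cylinder `O × J` on the object `O` (with walls
`{marked point} × J`, and the product orientation) onto an open subset of the surface with
defects `S`. The label of a wall of the cylinder, read in the direction of increasing `t ∈ J`, is the
label of the marked point. -/
structure DefectCylinder (S : DefectStructure M D) (O : BordObject D) (J : Set ℝ) where
  toFun : Fin O.length → Circle → ℝ → M
  isOpenEmbedding :
    Topology.IsOpenEmbedding (fun x : (Fin O.length × Circle) × J => toFun x.1.1 x.1.2 x.2)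
  local_iso : ∀ (i : Fin O.length) (θ : ℝ), ∀ t ∈ J,
    ∃ (e : OpenPartialHomeomorph M HalfPlane) (g : ℝ × ℝ → Plane) (g' : ℝ × ℝ →L[ℝ] Plane),
      IsOrientedChart e ∧ toFun i (Circle.exp θ) t ∈ e.source ∧
      g = (fun x => (e (toFun i (Circle.exp x.1) x.2)).1) ∧
      ContDiffWithinAt ℝ ∞ g (univ ×ˢ J) (θ, t) ∧
      g' = fderivWithin ℝ g (univ ×ˢ J) (θ, t) ∧
      0 < cross (g' (1, 0)) (g' (0, 1)) ∧
      (∀ x, (O.get i).d (Circle.exp θ) = Sum.inl x →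
        ∃ y, S.d (toFun i (Circle.exp θ) t) = .wall y ∧
          ReadsAlong (inChart e _ (S.dir (toFun i (Circle.exp θ) t))) (g' (0, 1)) y x) ∧
      (∀ a, (O.get i).d (Circle.exp θ) = Sum.inr a →
        S.d (toFun i (Circle.exp θ) t) = .region a)

/-- The image of the cylinder. -/
def DefectCylinder.image {S : DefectStructure M D} {O : BordObject D} {J : Set ℝ}
    (c : DefectCylinder S O J) : Set M :=
  {p | ∃ i z, ∃ t ∈ J, c.toFun i z t = p}

/-- The image of `O × {0}`. -/
def DefectCylinder.core {S : DefectStructure M D} {O : BordObject D} {J : Set ℝ}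
    (c : DefectCylinder S O J) : Set M :=
  {p | ∃ i z, c.toFun i z 0 = p}

/-- `f⁻¹(t)` is a generic cross-section: for some `ε > 0`, the set `f⁻¹((t - ε, t + ε))` is
isomorphic to an open cylinder or a collar on it. -/
def IsGenericCrossSection (S : DefectStructure M D) (f : M → ℝ) (t : ℝ) : Prop :=
  ∃ ε : ℝ, 0 < ε ∧ ∃ O : BordObject D,
    (∃ c : DefectCylinder S O (Ioo (-1) 1),
      c.image = f ⁻¹' Ioo (t - ε) (t + ε) ∧ c.core = f ⁻¹' {t}) ∨
    (∃ c : DefectCylinder S O (Ico 0 1),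
      c.image = f ⁻¹' Ioo (t - ε) (t + ε) ∧ c.core = f ⁻¹' {t})

/-- A height function for a surface with in-boundary `A` and out-boundary `B`: a Morse function to
`[0, 1]` which is `0` exactly on `A` and `1` exactly on `B`, without critical points on the
boundary. -/
structure IsHeightFunction (f : M → ℝ) (A B : Set M) : Prop where
  smooth : ContMDiff (𝓡∂ 2) 𝓘(ℝ, ℝ) ∞ f
  mem_Icc : ∀ p, f p ∈ Icc (0 : ℝ) 1
  zero : f ⁻¹' {0} = A
  one : f ⁻¹' {1} = B
  boundary_regular : ∀ p ∈ (𝓡∂ 2).boundary M, mfderiv (𝓡∂ 2) 𝓘(ℝ, ℝ) f p ≠ 0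
  nondegenerate : ∀ p, mfderiv (𝓡∂ 2) 𝓘(ℝ, ℝ) f p = 0 → ∀ v : Plane,
    (∀ w : Plane, fderiv ℝ (fderiv ℝ (f ∘ (extChartAt (𝓡∂ 2) p).symm))
      (extChartAt (𝓡∂ 2) p p) v w = 0) → v = 0

end Surface

/-- A bordism with defects from `U` to `V`, that is, a representative of a morphism from `U` to `V`
in the category of two-dimensional bordisms with defects: a compact oriented surface with defects,
whose boundary is the disjoint union of the in-boundary `U` and the out-boundary `V`, embedded with
collars. -/
structure DefectBordism {D : DefectData} (U V : BordObject D) where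
  carrier : Type
  [top : TopologicalSpace carrier]
  [charted : ChartedSpace HalfPlane carrier]
  [surface : OrientedSurface carrier]
  [compact : CompactSpace carrier]
  defects : DefectStructure carrier D
  inCollar : DefectCylinder defects U (Ico 0 1)
  outCollar : DefectCylinder defects V (Ioc (-1) 0)
  disjoint : Disjoint inCollar.core outCollar.core
  boundary_eq : (𝓡∂ 2).boundary carrier = inCollar.core ∪ outCollar.core
  height : carrier → ℝ
  isHeight : IsHeightFunction height inCollar.core outCollar.core
  /-- The distinguished points of the generic cross-sections: one on each circle of each of them.
  They lie in one component of the two-dimensional stratum. On the boundary they are the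
  distinguished points of the circles of `U` and `V`. -/
  base : Set carrier
  base_in : ∀ i, inCollar.toFun i (Circle.exp Real.pi) 0 ∈ base
  base_out : ∀ i, outCollar.toFun i (Circle.exp Real.pi) 0 ∈ base
  base_generic : ∀ t ∈ Icc (0 : ℝ) 1, IsGenericCrossSection defects height t →
    ∀ p ∈ height ⁻¹' {t}, ∃! b, b ∈ base ∧ b ∈ connectedComponentIn (height ⁻¹' {t}) p
  base_component : ∀ b ∈ base, (defects.d b).dim = 2 ∧
    base ⊆ connectedComponentIn {q | (defects.d q).dim = 2} b

/-- `U` and `V` are cobordant in the category of bordisms with defects. -/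
def DefectCobordant {D : DefectData} (U V : BordObject D) : Prop :=
  Nonempty (DefectBordism U V)

/-! ## The defect data of a group presentation -/

/-- The defect data of the presentation `⟨B ∣ R⟩`, where the relators are words in the letters
`(b, true) = b` and `(b, false) = b⁻¹`: one region label, walls labelled by generators, vertices
labelled by relators. -/
abbrev presentationDefectData {B : Type*} (R : Set (List (B × Bool))) : DefectData where
  D₂ := PUnit
  D₁ := B
  D₀ := R
  ψ₁₂ _ := (PUnit.unit, PUnit.unit)
  ψ₀₁ u := if u.2 then (u.1.1 : Cycle (B × Bool)) else (FreeGroup.invRev u.1.1 : Cycle (B × Bool))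
  ψ₁₂_inv _ := rfl
  ψ₀₁_inv := by
    rintro ⟨r, b⟩
    have key : ∀ l : List (B × Bool),
        (((l : Cycle (B × Bool)).map Signed.inv).reverse : Cycle (B × Bool)) =
          (FreeGroup.invRev l : Cycle (B × Bool)) := fun l => rfl
    cases b
    · change ((r.1 : List (B × Bool)) : Cycle (B × Bool)) =
        ((FreeGroup.invRev r.1 : Cycle (B × Bool)).map Signed.inv).reverse
      rw [key, FreeGroup.invRev_invRev]
    · exact (key r.1).symm
  composable u := Cycle.chain_of_pairwise fun _ _ _ _ => rfl

/-! No handles are needed: the bordism is the cylinder `S¹ × [0, T]` with height `t / T`, which has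
no critical points, and all the content lies in the walls and vertices drawn on it. Cut the cylinder
along the line over the distinguished point `-1`. In the remaining strip `-π < x < π` a word is a
row of vertical lines, one for each letter, and a passage between two words is a plane picture (a
`Pattern`) from one row to the other which stays away from the cut.

Equality in `⟨B ∣ R⟩` is generated by creating or cancelling adjacent inverse letters and by
inserting `r` or `r⁻¹`. Each of these has a picture: a parabolic cup or cap (`connects_cup`), and a
vertex from which lines go up (`connects_star`). The letters on both sides continue as vertical
lines (`connects_of_insert`). Sliding the lines without crossings (`connects_of_same_word`) makes
their positions irrelevant, and pictures can be stacked (`Connects.trans`). Deleting a relator needs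
no picture of its own: an element of the normal closure is a product of conjugates of `r` and `r⁻¹`,
and a word `w` is multiplied by such a conjugate by passing to `w l l⁻¹` and inserting `r` or `r⁻¹`
in the middle (`wordConnects_of_presentedGroup_eq`). Hence every vertex may have all its branches in
the upper half-plane.

The remaining work turns the local models of a picture (`Good`) into distinguished charts of the
cylinder. In the interior these come from the inverse function theorem (`exists_isLocalForm`). At
the boundary the picture consists of vertical lines, and the charts of the atlas already suffice
(`exists_isLocalForm_crd`). The cut lies in a region, so it serves as the connected set of
distinguished points. -/

/-! ## The cylinder as an oriented surface -/

/-- The cylinder `S¹ × [0, T]`. -/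
abbrev Cyl (T : ℝ) : Type := Circle × Icc (0 : ℝ) T

namespace Cyl

variable {T : ℝ}

/-- The sign of the chart coordinates at the lower (`true`) or upper (`false`) end. -/
def sg (σ : Bool) : ℝ := if σ then 1 else -1

@[simp] lemma sg_mul_self (σ : Bool) : sg σ * sg σ = 1 := by cases σ <;> norm_num [sg]

lemma sg_mul_sg_sq (σ τ : Bool) : (sg σ * sg τ) ^ 2 = 1 := by
  cases σ <;> cases τ <;> norm_num [sg]

/-- The rotation `(x, t) ↦ (t, -x)`. -/
noncomputable def rot : (ℝ × ℝ) ≃L[ℝ] Plane :=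
  LinearEquiv.toContinuousLinearEquiv
    { toFun := fun p => !₂[p.2, -p.1]
      invFun := fun y => (-y 1, y 0)
      map_add' := fun p q => by ext i; fin_cases i <;> simp; ring
      map_smul' := fun a p => by ext i; fin_cases i <;> simp
      left_inv := fun p => by simp
      right_inv := fun y => by ext i; fin_cases i <;> simp }

@[simp] lemma rot_apply (p : ℝ × ℝ) : rot p = !₂[p.2, -p.1] := rfl
@[simp] lemma rot_symm_apply (y : Plane) : rot.symm y = (-y 1, y 0) := rfl

/-- The origin of the chart coordinates. -/
noncomputable def org (T : ℝ) (σ : Bool) : Plane := if σ then 0 else !₂[T, 0]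

/-- The coordinates `(t, -x)`, respectively `(T - t, x)`, on the strip. -/
noncomputable def crd (T : ℝ) (σ : Bool) (p : ℝ × ℝ) : Plane := org T σ + sg σ • rot p

/-- The inverse of `crd`. -/
noncomputable def crdInv (T : ℝ) (σ : Bool) (y : Plane) : ℝ × ℝ :=
  rot.symm (sg σ • (y - org T σ))

@[simp] lemma crdInv_crd (σ : Bool) (p : ℝ × ℝ) : crdInv T σ (crd T σ p) = p := by
  simp only [crdInv, crd, add_sub_cancel_left, smul_smul, sg_mul_self, one_smul,
    ContinuousLinearEquiv.symm_apply_apply]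

@[simp] lemma crd_crdInv (σ : Bool) (y : Plane) : crd T σ (crdInv T σ y) = y := by
  simp only [crdInv, crd, smul_smul, sg_mul_self, one_smul, add_sub_cancel,
    ContinuousLinearEquiv.apply_symm_apply]

lemma crd_zero (σ : Bool) (p : ℝ × ℝ) : crd T σ p 0 = if σ then p.2 else T - p.2 := by
  cases σ <;> simp [crd, org, sg]; ring

lemma crd_one (σ : Bool) (p : ℝ × ℝ) : crd T σ p 1 = -(sg σ * p.1) := by
  cases σ <;> simp [crd, org, sg]

lemma crdInv_snd (σ : Bool) (y : Plane) : (crdInv T σ y).2 = if σ then y 0 else T - y 0 := by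
  cases σ <;> simp [crdInv, org, sg]

lemma contDiff_crd (σ : Bool) : ContDiff ℝ ∞ (crd T σ) :=
  contDiff_const.add (rot.contDiff.const_smul _)

lemma contDiff_crdInv (σ : Bool) : ContDiff ℝ ∞ (crdInv T σ) :=
  rot.symm.contDiff.comp ((contDiff_id.sub contDiff_const).const_smul _)

lemma hasFDerivAt_crd (σ : Bool) (p : ℝ × ℝ) :
    HasFDerivAt (crd T σ) (sg σ • (rot : (ℝ × ℝ) →L[ℝ] Plane)) p :=
  (rot.hasFDerivAt.const_smul (sg σ)).const_add _

lemma hasFDerivAt_crdInv (σ : Bool) (y : Plane) :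
    HasFDerivAt (crdInv T σ) (sg σ • (rot.symm : Plane →L[ℝ] (ℝ × ℝ))) y := by
  have h := rot.symm.hasFDerivAt.comp y
    (((hasFDerivAt_id y).sub_const (org T σ)).const_smul (sg σ))
  refine h.congr_fderiv ?_
  ext v <;> simp

/-- The strip which covers the cylinder. -/
def strip (T : ℝ) : Set (ℝ × ℝ) := univ ×ˢ Icc 0 T

@[simp] lemma mem_strip {p : ℝ × ℝ} : p ∈ strip T ↔ p.2 ∈ Icc 0 T := by simp [strip]

/-- Both coordinate systems are translates of `± rot`, so passing between them is a translation or a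
point reflection. In the plane both preserve orientation, which is why the two kinds of ends fit
into one oriented atlas. -/
lemma crd_add_smul (σ τ : Bool) (k : ℝ) : ∃ a : Plane, ∀ z,
    crd T τ (crdInv T σ z + (k, 0)) = (sg σ * sg τ) • z + a := by
  refine ⟨org T τ - (sg σ * sg τ) • org T σ + sg τ • rot (k, 0), fun z => ?_⟩
  simp only [crd, crdInv, map_add, ContinuousLinearEquiv.apply_symm_apply]
  module

variable [hT : Fact (0 < T)]

/-- The map `(x, t) ↦ (exp (ix), t)`. -/
noncomputable def cover (p : ℝ × ℝ) : Cyl T :=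
  (Circle.exp p.1, projIcc 0 T hT.out.le p.2)

lemma continuous_cover : Continuous (cover : ℝ × ℝ → Cyl T) :=
  (Circle.exp.continuous.comp continuous_fst).prodMk (continuous_projIcc.comp continuous_snd)

lemma cover_eq {p : ℝ × ℝ} (hp : p ∈ strip T) :
    (cover p : Cyl T) = (Circle.exp p.1, ⟨p.2, mem_strip.1 hp⟩) := by
  rw [cover, projIcc_of_mem]

lemma cover_surj (q : Cyl T) :
    (cover (Complex.arg q.1, q.2) : Cyl T) = q := by
  rw [cover_eq (by simp)]
  exact Prod.ext (Circle.exp_arg q.1) rfl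

lemma cover_add {p : ℝ × ℝ} {k : ℝ} (hk : Circle.exp k = 1) :
    (cover (p + (k, 0)) : Cyl T) = cover p := by
  unfold cover; simp [Circle.exp_add, hk]

lemma mem_range_I {y : Plane} : y ∈ range (𝓡∂ 2) ↔ 0 ≤ y 0 := by
  rw [range_modelWithCornersEuclideanHalfSpace]; rfl

lemma I_symm_val {y : Plane} (hy : y ∈ range (𝓡∂ 2)) : ((𝓡∂ 2).symm y).1 = y :=
  (𝓡∂ 2).right_inv hy

/-! ### The atlas: branches of the angle, combined with the two ends. -/

/-- The chart of the cylinder given by an inverse branch `f` of the exponential map and an end `σ`. -/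
noncomputable def chart (f : OpenPartialHomeomorph ℝ Circle) (hf : ⇑f = Circle.exp) (σ : Bool) :
    OpenPartialHomeomorph (Cyl T) HalfPlane where
  toFun q := ⟨crd T σ (f.symm q.1, q.2), by
    rw [crd_zero]; have := q.2.2; cases σ <;> simp [this.1, this.2]⟩
  invFun y := cover (crdInv T σ y.1)
  -- The strict inequality removes the end opposite to `σ`, which is not on the boundary line of the
  -- half-plane in these coordinates.
  source := {q | q.1 ∈ f.target ∧ crd T σ (0, q.2) 0 < T}
  target := {y | (crdInv T σ y.1).1 ∈ f.source ∧ y.1 0 < T}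
  map_source' q hq := by
    refine ⟨?_, ?_⟩
    · simpa using f.map_target hq.1
    · have := hq.2; simp only [crd_zero] at this ⊢; exact this
  map_target' y hy := by
    have h0 := y.2
    have h1 := crdInv_snd (T := T) σ y.1
    have hm : crdInv T σ y.1 ∈ strip T := by
      rw [mem_strip, h1]; cases σ <;> simp [h0, hy.2.le]
    rw [cover_eq hm]
    refine ⟨by rw [← hf]; exact f.map_source hy.1, ?_⟩
    have := hy.2
    simp only [crd_zero, h1]
    cases σ <;> simpa
  left_inv' q hq := by
    simp only [crdInv_crd]
    rw [cover_eq (by simp)]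
    exact Prod.ext (by simpa [hf] using f.right_inv hq.1) rfl
  right_inv' y hy := by
    have h0 := y.2
    have h1 := crdInv_snd (T := T) σ y.1
    have hm : crdInv T σ y.1 ∈ strip T := by
      rw [mem_strip, h1]; cases σ <;> simp [h0, hy.2.le]
    apply Subtype.ext
    simp only [cover_eq hm]
    rw [← hf, f.left_inv hy.1]
    exact crd_crdInv σ y.1
  open_source := by
    have h1 : Continuous fun q : Cyl T => crd T σ (0, q.2) 0 := by
      have : Continuous fun q : Cyl T => crd T σ (0, q.2) := (contDiff_crd σ).continuous.comp
        (continuous_const.prodMk (continuous_subtype_val.comp continuous_snd))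
      fun_prop
    exact (f.open_target.preimage continuous_fst).inter (isOpen_lt h1 continuous_const)
  open_target := by
    have hv : Continuous fun y : HalfPlane => y.1 := continuous_subtype_val
    refine (f.open_source.preimage (continuous_fst.comp
      ((contDiff_crdInv σ).continuous.comp hv))).inter
      (isOpen_lt (f := fun y : HalfPlane => y.1 0) ?_ continuous_const)
    exact (PiLp.continuous_apply 2 _ 0).comp hv
  continuousOn_toFun := by
    refine Topology.IsInducing.subtypeVal.continuousOn_iff.2 ?_
    refine (contDiff_crd σ).continuous.comp_continuousOn
      (ContinuousOn.prodMk ?_ (continuous_subtype_val.comp continuous_snd).continuousOn)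
    exact f.continuousOn_symm.comp continuous_fst.continuousOn (fun q hq => hq.1)
  continuousOn_invFun := (continuous_cover.comp
    ((contDiff_crdInv σ).continuous.comp continuous_subtype_val)).continuousOn

section chart

variable (f : OpenPartialHomeomorph ℝ Circle) (hf : ⇑f = Circle.exp) (σ : Bool)

lemma chart_val (q : Cyl T) : (chart f hf σ q).1 = crd T σ (f.symm q.1, q.2) := rfl

lemma chart_symm (y : HalfPlane) :
    ((chart f hf σ).symm y : Cyl T) = cover (crdInv T σ y.1) := rfl

lemma mem_chart_source {q : Cyl T} :
    q ∈ (chart f hf σ).source ↔ q.1 ∈ f.target ∧ crd T σ (0, q.2) 0 < T := Iff.rfl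

end chart

/-- An inverse branch of the exponential map near a given angle. -/
noncomputable def branch (x : ℝ) : OpenPartialHomeomorph ℝ Circle :=
  (isLocalHomeomorph_circleExp x).choose

lemma mem_branch (x : ℝ) : x ∈ (branch x).source := (isLocalHomeomorph_circleExp x).choose_spec.1

lemma branch_eq (x : ℝ) : ⇑(branch x) = Circle.exp :=
  (isLocalHomeomorph_circleExp x).choose_spec.2.symm

lemma exp_mem_branch (x : ℝ) : Circle.exp x ∈ (branch x).target := by
  have := (branch x).map_source (mem_branch x); rwa [branch_eq] at this

open Classical in
/-- The end towards which the preferred chart at a point is directed. -/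
noncomputable def side (q : Cyl T) : Bool := decide ((q.2 : ℝ) < T)

lemma crd_side_lt (q : Cyl T) : crd T (side q) (0, q.2) 0 < T := by
  rw [crd_zero]
  by_cases h : (q.2 : ℝ) < T
  · simp [side, h]
  · have h1 : (q.2 : ℝ) = T := le_antisymm q.2.2.2 (not_lt.1 h)
    have := hT.out
    simp [side, h1, this]

noncomputable instance : ChartedSpace HalfPlane (Cyl T) where
  atlas := {e | ∃ f hf σ, e = chart f hf σ}
  chartAt q := chart (branch (Complex.arg q.1)) (branch_eq _) (side q)
  mem_chart_source q := by
    refine ⟨?_, crd_side_lt q⟩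
    have := exp_mem_branch (Complex.arg q.1)
    rwa [Circle.exp_arg] at this
  chart_mem_atlas q := ⟨_, _, _, rfl⟩

lemma chart_mem_atlas' (f : OpenPartialHomeomorph ℝ Circle) (hf : ⇑f = Circle.exp) (σ : Bool) :
    chart f hf σ ∈ atlas HalfPlane (Cyl T) := ⟨f, hf, σ, rfl⟩

lemma chartAt_eq (q : Cyl T) :
    chartAt HalfPlane q = chart (branch (Complex.arg q.1)) (branch_eq _) (side q) := rfl

/-- Two branches of the angle differ locally by a constant. -/
lemma branch_change {f : OpenPartialHomeomorph ℝ Circle} (hf : ⇑f = Circle.exp) {x : ℝ}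
    (hx : Circle.exp x ∈ f.target) :
    ∃ k : ℝ, Circle.exp k = 1 ∧ ∀ᶠ z in 𝓝 x, f.symm (Circle.exp z) = z + k := by
  have h1 : Circle.exp (f.symm (Circle.exp x)) = Circle.exp x := by
    rw [← hf]; exact f.right_inv (by rwa [hf])
  refine ⟨f.symm (Circle.exp x) - x, by rw [Circle.exp_sub, h1, div_self'], ?_⟩
  have hc : Filter.Tendsto (fun z : ℝ => z + (f.symm (Circle.exp x) - x)) (𝓝 x)
      (𝓝 (f.symm (Circle.exp x))) := by
    have : Continuous fun z : ℝ => z + (f.symm (Circle.exp x) - x) := by fun_prop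
    simpa using this.tendsto x
  filter_upwards [hc (f.open_source.mem_nhds (f.map_target hx))] with z hz
  have h2 : Circle.exp z = f (z + (f.symm (Circle.exp x) - x)) := by
    rw [hf, Circle.exp_add, Circle.exp_sub, h1, div_self', mul_one]
  rw [h2, f.left_inv hz]

/-- The changes of coordinates are locally `z ↦ ± z + a`. -/
lemma transition {f' : OpenPartialHomeomorph ℝ Circle}
    (hf' : ⇑f' = Circle.exp) (σ τ : Bool) {y : Plane} (hyT : y 0 < T)
    (hy' : (cover (crdInv T σ y) : Cyl T) ∈ (chart f' hf' τ).source) :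
    ∃ a : Plane, ∀ᶠ z in 𝓝[range (𝓡∂ 2)] y,
      (chart f' hf' τ (cover (crdInv T σ z) : Cyl T)).1 = (sg σ * sg τ) • z + a := by
  obtain ⟨k, -, hk⟩ := branch_change hf' (x := (crdInv T σ y).1) hy'.1
  obtain ⟨a, ha⟩ := crd_add_smul (T := T) σ τ k
  refine ⟨a, ?_⟩
  have hc : Continuous fun z => (crdInv T σ z).1 :=
    continuous_fst.comp (contDiff_crdInv σ).continuous
  have h0 : Continuous fun z : Plane => z 0 := by fun_prop
  filter_upwards [self_mem_nhdsWithin, nhdsWithin_le_nhds (hc.tendsto y hk),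
    nhdsWithin_le_nhds ((isOpen_lt h0 continuous_const).mem_nhds hyT)] with z hz hz1 hz2
  have hm : crdInv T σ z ∈ strip T := by
    rw [mem_strip, crdInv_snd]
    have h3 := mem_range_I.1 hz
    have h4 : z 0 < T := hz2
    cases σ <;> simp [h3, h4.le]
  rw [cover_eq hm, chart_val, ← ha]
  congr 1
  rw [show f'.symm (Circle.exp (crdInv T σ z).1) = _ from hz1]
  ext <;> simp

/-- The sign depends only on the two charts. The translation may vary from point to point, since two
branches of the angle can differ by different multiples of `2π` on different parts of an overlap. -/
lemma transition_atlas {e e' : OpenPartialHomeomorph (Cyl T) HalfPlane}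
    (he : e ∈ atlas HalfPlane (Cyl T)) (he' : e' ∈ atlas HalfPlane (Cyl T)) :
    ∃ s : ℝ, s ^ 2 = 1 ∧ ∀ y ∈ e.target, e.symm y ∈ e'.source →
      ∃ a : Plane, ∀ᶠ z in 𝓝[range (𝓡∂ 2)] y.1,
        (e' (e.symm ((𝓡∂ 2).symm z))).1 = s • z + a := by
  obtain ⟨f, hf, σ, rfl⟩ := he
  obtain ⟨f', hf', τ, rfl⟩ := he'
  refine ⟨sg σ * sg τ, sg_mul_sg_sq σ τ, fun y hy hy' => ?_⟩
  obtain ⟨a, ha⟩ := transition hf' σ τ hy.2 hy'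
  refine ⟨a, ?_⟩
  filter_upwards [ha, self_mem_nhdsWithin] with z hz hz'
  rw [chart_symm, I_symm_val hz', hz]

instance : IsManifold (𝓡∂ 2) ∞ (Cyl T) := by
  refine isManifold_of_contDiffOn _ _ _ fun e e' he he' => ?_
  obtain ⟨s, -, h⟩ := transition_atlas he he'
  rintro _ ⟨hy, y, rfl⟩
  simp only [mem_preimage, ModelWithCorners.left_inv, OpenPartialHomeomorph.trans_source,
    OpenPartialHomeomorph.symm_source, mem_inter_iff] at hy
  obtain ⟨a, ha⟩ := h y hy.1 hy.2
  have h1 : ContDiff ℝ ∞ fun z : Plane => s • z + a :=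
    (contDiff_id.const_smul s).add contDiff_const
  exact (h1.contDiffAt.contDiffWithinAt.congr_of_eventuallyEq_of_mem ha (mem_range_self y)).mono
    inter_subset_right

lemma det_smul_plane (s : ℝ) (D : Plane →L[ℝ] Plane) : (s • D).det = s ^ 2 * D.det := by
  have := LinearMap.det_smul s (D : Plane →ₗ[ℝ] Plane)
  simp only [finrank_euclideanSpace, Fintype.card_fin] at this
  exact this

lemma uniqueDiff_range (y : HalfPlane) : UniqueDiffWithinAt ℝ (range (𝓡∂ 2)) y.1 :=
  (𝓡∂ 2).uniqueDiffOn _ (mem_range_self y)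

instance : OrientedSurface (Cyl T) where
  smooth := inferInstance
  t2 := inferInstance
  second_countable := inferInstance
  oriented e he e' he' q hq := by
    obtain ⟨s, hs, h⟩ := transition_atlas he he'
    obtain ⟨a, ha⟩ := h (e q) (e.map_source hq.1) (by rw [e.left_inv hq.1]; exact hq.2)
    have h1 : HasFDerivAt (fun z : Plane => s • z + a) (s • ContinuousLinearMap.id ℝ Plane) (e q).1 :=
      ((hasFDerivAt_id _).const_smul s).add_const a
    have h2 : HasFDerivWithinAt (e'.extend (𝓡∂ 2) ∘ (e.extend (𝓡∂ 2)).symm)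
        (s • ContinuousLinearMap.id ℝ Plane) (range (𝓡∂ 2)) (e q).1 :=
      (h1.hasFDerivWithinAt (s := range (𝓡∂ 2))).congr_of_eventuallyEq ha
        (ha.self_of_nhdsWithin (mem_range_self (e q)))
    rw [show e.extend (𝓡∂ 2) q = (e q).1 from rfl, h2.fderivWithin (uniqueDiff_range _),
      det_smul_plane, hs, ContinuousLinearMap.det]
    simp

/-! ### Tangent vectors and charts in the coordinates `(x, t)`. -/

/-- A tangent vector of the cylinder at `q`, from its components in the directions of `x` and `t`. -/
noncomputable def vec (q : Cyl T) (v : ℝ × ℝ) : TangentSpace (𝓡∂ 2) q :=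
  -- The tangent space at `q` is the model plane seen through the preferred chart, and `sg (side q)
  -- • rot` is the derivative of that chart in the coordinates `(x, t)`.
  (sg (side q) • rot v : Plane)

/-- `e` is an oriented chart whose expression in the coordinates `(x, t)` is `Ψ`, and whose domain is
covered by `N`. -/
structure IsLocalForm (e : OpenPartialHomeomorph (Cyl T) HalfPlane) (Ψ : ℝ × ℝ → Plane)
    (N : Set (ℝ × ℝ)) : Prop where
  oriented : IsOrientedChart e
  rep : ∀ q ∈ e.source, ∃ p ∈ N ∩ strip T, q = cover p ∧ (e q).1 = Ψ p ∧
    ∀ v, inChart e q (vec q v) = fderiv ℝ Ψ p v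

lemma chartAt_extend_symm (q : Cyl T) {z : Plane} (hz : z ∈ range (𝓡∂ 2)) :
    (extChartAt (𝓡∂ 2) q).symm z = cover (crdInv T (side q) z) := by
  change (chartAt HalfPlane q).symm ((𝓡∂ 2).symm z) = _
  rw [chartAt_eq, chart_symm, I_symm_val hz]

lemma extChartAt_self (q : Cyl T) : ∃ x : ℝ, Circle.exp x = q.1 ∧
    extChartAt (𝓡∂ 2) q q = crd T (side q) (x, q.2) := by
  refine ⟨(branch (Complex.arg q.1)).symm q.1, ?_, rfl⟩
  have := exp_mem_branch (Complex.arg q.1)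
  rw [Circle.exp_arg] at this
  rw [← branch_eq (Complex.arg q.1)]
  exact (branch _).right_inv this

/-- The passage from a preferred chart at `q = cover p` to the coordinates `(x, t)` near `p`. -/
lemma preferred_coordinates {q : Cyl T} {p : ℝ × ℝ} (hp : p ∈ strip T) (hq : q = cover p) :
    ∃ k : ℝ, crdInv T (side q) (extChartAt (𝓡∂ 2) q q) + (k, 0) = p ∧
      Filter.Tendsto (fun z => crdInv T (side q) z + (k, 0))
        (𝓝[range (𝓡∂ 2)] (extChartAt (𝓡∂ 2) q q)) (𝓝[strip T] p) ∧
      (∀ z ∈ range (𝓡∂ 2), (extChartAt (𝓡∂ 2) q).symm z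
        = cover (crdInv T (side q) z + (k, 0))) := by
  obtain ⟨x, hx, he⟩ := extChartAt_self q
  have hq' : q = (Circle.exp p.1, ⟨p.2, mem_strip.1 hp⟩) := hq.trans (cover_eq hp)
  have hk : Circle.exp (p.1 - x) = 1 := by
    rw [Circle.exp_sub, hx, hq', div_self']
  have h0 : crdInv T (side q) (extChartAt (𝓡∂ 2) q q) + (p.1 - x, 0) = p := by
    rw [he, crdInv_crd, hq']; ext <;> simp
  refine ⟨p.1 - x, h0, ?_, fun z hz => ?_⟩
  · have hc : Continuous fun z => crdInv T (side q) z + (p.1 - x, 0) :=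
      (contDiff_crdInv _).continuous.add continuous_const
    refine tendsto_nhdsWithin_iff.2 ⟨?_, ?_⟩
    · have := hc.tendsto (extChartAt (𝓡∂ 2) q q)
      rw [h0] at this
      exact this.mono_left nhdsWithin_le_nhds
    · have h1 : (extChartAt (𝓡∂ 2) q q) 0 < T := by
        rw [he]; have := crd_side_lt q; rw [crd_zero] at this ⊢; exact this
      have h2 : Continuous fun z : Plane => z 0 := by fun_prop
      filter_upwards [self_mem_nhdsWithin,
        nhdsWithin_le_nhds ((isOpen_lt h2 continuous_const).mem_nhds h1)] with z hz hz1
      have h3 := mem_range_I.1 hz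
      have h4 : z 0 < T := hz1
      have h5 := crdInv_snd (T := T) (side q) z
      simp only [mem_strip, Prod.snd_add, add_zero, h5]
      cases side q <;> simp [h3, h4.le]
  · rw [chartAt_extend_symm q hz, cover_add hk]

/-- In the preferred chart `g` is `Ψ` after an affine map, so this is the chain rule. As `Ψ` is
differentiable on a full neighbourhood in the plane, boundary points need no separate treatment. -/
lemma hasFDerivWithinAt_preferred {F : Type*} [NormedAddCommGroup F] [NormedSpace ℝ F]
    {q : Cyl T} {p : ℝ × ℝ} (hp : p ∈ strip T) (hq : q = cover p) {g : Cyl T → F}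
    {Ψ : ℝ × ℝ → F} (hΨ : DifferentiableAt ℝ Ψ p)
    (hg : ∀ᶠ z in 𝓝[strip T] p, g (cover z) = Ψ z) :
    HasFDerivWithinAt (g ∘ (extChartAt (𝓡∂ 2) q).symm)
      (fderiv ℝ Ψ p ∘L (sg (side q) • (rot.symm : Plane →L[ℝ] (ℝ × ℝ)))) (range (𝓡∂ 2))
      (extChartAt (𝓡∂ 2) q q) := by
  obtain ⟨k, h0, ht, hs⟩ := preferred_coordinates hp hq
  have h1 : HasFDerivAt (fun z => crdInv T (side q) z + (k, 0))
      (sg (side q) • (rot.symm : Plane →L[ℝ] (ℝ × ℝ))) (extChartAt (𝓡∂ 2) q q) :=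
    (hasFDerivAt_crdInv (side q) _).add_const _
  have h2 : HasFDerivAt (fun z => Ψ (crdInv T (side q) z + (k, 0))) _ (extChartAt (𝓡∂ 2) q q) :=
    HasFDerivAt.comp (g := Ψ) (extChartAt (𝓡∂ 2) q q) (by rw [h0]; exact hΨ.hasFDerivAt) h1
  have h3 : ∀ᶠ z in 𝓝[range (𝓡∂ 2)] (extChartAt (𝓡∂ 2) q q),
      (g ∘ (extChartAt (𝓡∂ 2) q).symm) z = Ψ (crdInv T (side q) z + (k, 0)) := by
    filter_upwards [ht.eventually hg, self_mem_nhdsWithin] with z hz hz'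
    rw [Function.comp_apply, hs z hz', hz]
  have h4 := h2.hasFDerivWithinAt (s := range (𝓡∂ 2)) |>.congr_of_eventuallyEq h3
    (h3.self_of_nhdsWithin ((chartAt HalfPlane q q).2 |> fun h => mem_range_I.2 h))
  exact h4

/-- The factor `sg (side q) • rot` in `vec` cancels against the inverse factor in the derivative of
the preferred coordinates. The choice of preferred chart thus disappears from all later computations
with directions. -/
lemma inChart_vec {e : OpenPartialHomeomorph (Cyl T) HalfPlane} (he : IsOrientedChart e) {q : Cyl T}
    (hqe : q ∈ e.source) {p : ℝ × ℝ} (hp : p ∈ strip T) (hq : q = cover p) {Ψ : ℝ × ℝ → Plane}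
    (hΨ : DifferentiableAt ℝ Ψ p) (hg : ∀ᶠ z in 𝓝[strip T] p, (e (cover z)).1 = Ψ z) (v : ℝ × ℝ) :
    inChart e q (vec q v) = fderiv ℝ Ψ p v := by
  have hm : MDifferentiableAt (𝓡∂ 2) (𝓡∂ 2) e q :=
    (contMDiffAt_of_mem_maximalAtlas he.1 hqe).mdifferentiableAt (by simp)
  have h := hasFDerivWithinAt_preferred (g := fun q => (e q).1) hp hq hΨ hg
  rw [inChart, hm.mfderiv]
  have h2 : writtenInExtChartAt (𝓡∂ 2) (𝓡∂ 2) q e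
      = (fun q => (e q).1) ∘ (extChartAt (𝓡∂ 2) q).symm := rfl
  rw [h2, h.fderivWithin ((𝓡∂ 2).uniqueDiffOn _ ?_)]
  · change fderiv ℝ Ψ p (sg (side q) • rot.symm (sg (side q) • rot v)) = _
    rw [map_smul rot.symm, smul_smul, sg_mul_self, one_smul, rot.symm_apply_apply]
  · exact mem_range_self _

/-- Composition of a chart of the atlas with an oriented change of coordinates. -/
lemma isOrientedChart_trans {c : OpenPartialHomeomorph (Cyl T) HalfPlane}
    (hc : c ∈ atlas HalfPlane (Cyl T)) {Φ : OpenPartialHomeomorph HalfPlane HalfPlane}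
    (hΦ : Φ ∈ contDiffGroupoid ∞ (𝓡∂ 2))
    (hd : ∀ y ∈ Φ.target, ∃ D : Plane →L[ℝ] Plane, 0 < D.det ∧
      HasFDerivWithinAt (fun z => (Φ.symm ((𝓡∂ 2).symm z)).1) D (range (𝓡∂ 2)) y.1) :
    IsOrientedChart (c ≫ₕ Φ) := by
  refine ⟨?_, fun e' he' q hq => ?_⟩
  · rw [IsManifold.maximalAtlas, mem_maximalAtlas_iff]
    intro e' he'
    have h1 := HasGroupoid.compatible (G := contDiffGroupoid ∞ (𝓡∂ 2)) hc he'
    have h2 := HasGroupoid.compatible (G := contDiffGroupoid ∞ (𝓡∂ 2)) he' hc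
    constructor
    · rw [OpenPartialHomeomorph.trans_symm_eq_symm_trans_symm, OpenPartialHomeomorph.trans_assoc]
      exact StructureGroupoid.trans _ (StructureGroupoid.symm _ hΦ) h1
    · rw [← OpenPartialHomeomorph.trans_assoc]
      exact StructureGroupoid.trans _ h2 hΦ
  · obtain ⟨s, hs, h⟩ := transition_atlas hc he'
    have hqc : q ∈ c.source := hq.1.1
    have hqΦ : c q ∈ Φ.source := hq.1.2
    obtain ⟨a, ha⟩ := h (c q) (c.map_source hqc) (by rw [c.left_inv hqc]; exact hq.2)
    obtain ⟨D, hD, hD'⟩ := hd (Φ (c q)) (Φ.map_source hqΦ)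
    have hval : (Φ.symm ((𝓡∂ 2).symm (Φ (c q)).1)).1 = (c q).1 := by
      have : (𝓡∂ 2).symm (Φ (c q)).1 = Φ (c q) := (𝓡∂ 2).left_inv _
      rw [this, Φ.left_inv hqΦ]
    have h1 : HasFDerivAt (fun z : Plane => s • z + a) (s • ContinuousLinearMap.id ℝ Plane)
        (Φ.symm ((𝓡∂ 2).symm (Φ (c q)).1)).1 :=
      ((hasFDerivAt_id _).const_smul s).add_const a
    have h2 := HasFDerivAt.comp_hasFDerivWithinAt (g := fun z : Plane => s • z + a)
      (f := fun z => (Φ.symm ((𝓡∂ 2).symm z)).1) _ h1 hD'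
    have ht : Filter.Tendsto (fun z => (Φ.symm ((𝓡∂ 2).symm z)).1)
        (𝓝[range (𝓡∂ 2)] (Φ (c q)).1) (𝓝[range (𝓡∂ 2)] (c q).1) := by
      refine tendsto_nhdsWithin_iff.2 ⟨?_, Filter.Eventually.of_forall fun z => mem_range_self _⟩
      have := hD'.continuousWithinAt.tendsto
      rwa [hval] at this
    have h3 : ∀ᶠ z in 𝓝[range (𝓡∂ 2)] (Φ (c q)).1,
        (e'.extend (𝓡∂ 2) ∘ ((c ≫ₕ Φ).extend (𝓡∂ 2)).symm) z
          = s • (Φ.symm ((𝓡∂ 2).symm z)).1 + a := by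
      filter_upwards [ht.eventually ha] with z hz
      have : (𝓡∂ 2).symm (Φ.symm ((𝓡∂ 2).symm z)).1 = Φ.symm ((𝓡∂ 2).symm z) :=
        (𝓡∂ 2).left_inv _
      rw [this] at hz
      exact hz
    have h4 := h2.congr_of_eventuallyEq h3 (h3.self_of_nhdsWithin (mem_range_self _))
    have h5 : (fderivWithin ℝ (e'.extend (𝓡∂ 2) ∘ ((c ≫ₕ Φ).extend (𝓡∂ 2)).symm) (range (𝓡∂ 2))
        ((c ≫ₕ Φ).extend (𝓡∂ 2) q)) = s • D := by
      refine (h4.fderivWithin (uniqueDiff_range _)).trans ?_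
      ext v; simp
    rw [h5, det_smul_plane, hs, one_mul]
    exact hD

/-- All adapted charts arise in this way: a chart of the atlas followed by an oriented change of
coordinates `Φ`, where `Φ` is chosen so that the composite reads `Ψ` in the coordinates `(x, t)`. -/
lemma isLocalForm_trans (x : ℝ) (σ : Bool) {Φ : OpenPartialHomeomorph HalfPlane HalfPlane}
    (hΦ : Φ ∈ contDiffGroupoid ∞ (𝓡∂ 2))
    (hd : ∀ y ∈ Φ.target, ∃ D : Plane →L[ℝ] Plane, 0 < D.det ∧
      HasFDerivWithinAt (fun z => (Φ.symm ((𝓡∂ 2).symm z)).1) D (range (𝓡∂ 2)) y.1)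
    {Ψ : ℝ × ℝ → Plane} (hΨ : Differentiable ℝ Ψ) {N : Set (ℝ × ℝ)}
    (hN : ∀ y ∈ Φ.source, crdInv T σ y.1 ∈ N ∧ (Φ y).1 = Ψ (crdInv T σ y.1)) :
    IsLocalForm (chart (branch x) (branch_eq x) σ ≫ₕ Φ : OpenPartialHomeomorph (Cyl T) HalfPlane)
      Ψ N := by
  have ho := isOrientedChart_trans (chart_mem_atlas' (T := T) (branch x) (branch_eq x) σ) hΦ hd
  refine ⟨ho, fun q hq => ?_⟩
  have hqc : q ∈ (chart (branch x) (branch_eq x) σ).source := hq.1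
  have hqΦ : chart (branch x) (branch_eq x) σ q ∈ Φ.source := hq.2
  have h1 := hN _ hqΦ
  rw [chart_val, crdInv_crd] at h1
  set p : ℝ × ℝ := ((branch x).symm q.1, (q.2 : ℝ)) with hp
  have hps : p ∈ strip T := by rw [mem_strip]; exact q.2.2
  have hexp : Circle.exp p.1 = q.1 := by
    rw [← branch_eq x]; exact (branch x).right_inv hqc.1
  have hqp : q = cover p := by
    rw [cover_eq hps]; exact Prod.ext hexp.symm rfl
  refine ⟨p, ⟨h1.1, hps⟩, hqp, h1.2, fun v => ?_⟩
  refine inChart_vec ho hq hps hqp (hΨ p) ?_ v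
  have hps' : p.1 ∈ (branch x).source := (branch x).map_target hqc.1
  have ha : ∀ᶠ z in 𝓝[strip T] p,
      (cover z : Cyl T) ∈ (chart (branch x) (branch_eq x) σ ≫ₕ Φ).source := by
    refine nhdsWithin_le_nhds (continuous_cover.tendsto p ?_)
    rw [← hqp]
    exact (OpenPartialHomeomorph.open_source _).mem_nhds hq
  filter_upwards [ha, self_mem_nhdsWithin,
    nhdsWithin_le_nhds (((branch x).open_source.preimage continuous_fst).mem_nhds hps')]
    with z hz1 hz2 hz3
  have h2 := (hN _ hz1.2).2
  have h3 : crdInv T σ (chart (branch x) (branch_eq x) σ (cover z : Cyl T)).1 = z := by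
    rw [chart_val, crdInv_crd, cover_eq hz2, ← branch_eq x, (branch x).left_inv hz3]
  have h4 : (Φ (chart (branch x) (branch_eq x) σ (cover z : Cyl T))).1
      = Ψ (crdInv T σ (chart (branch x) (branch_eq x) σ (cover z : Cyl T)).1) := h2
  rw [h3] at h4
  exact h4

end Cyl

/-! ### Adapted charts from maps with positive Jacobian determinant. -/

namespace Cyl

variable {T : ℝ}

/-- A homeomorphism between open subsets of the open half-plane. -/
noncomputable def halfPlaneHomeo (Θ : OpenPartialHomeomorph Plane Plane)
    (hs : ∀ y ∈ Θ.source, 0 < y 0) (ht : ∀ y ∈ Θ.target, 0 < y 0) :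
    OpenPartialHomeomorph HalfPlane HalfPlane where
  toFun y := (𝓡∂ 2).symm (Θ y.1)
  invFun y := (𝓡∂ 2).symm (Θ.symm y.1)
  source := {y | y.1 ∈ Θ.source}
  target := {y | y.1 ∈ Θ.target}
  map_source' y hy := by
    have h := Θ.map_source hy
    rwa [mem_ofPred_eq, I_symm_val (mem_range_I.2 (ht _ h).le)]
  map_target' y hy := by
    have h := Θ.map_target hy
    rwa [mem_ofPred_eq, I_symm_val (mem_range_I.2 (hs _ h).le)]
  left_inv' y hy := by
    rw [I_symm_val (mem_range_I.2 (ht _ (Θ.map_source hy)).le), Θ.left_inv hy]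
    exact (𝓡∂ 2).left_inv y
  right_inv' y hy := by
    rw [I_symm_val (mem_range_I.2 (hs _ (Θ.map_target hy)).le), Θ.right_inv hy]
    exact (𝓡∂ 2).left_inv y
  open_source := Θ.open_source.preimage continuous_subtype_val
  open_target := Θ.open_target.preimage continuous_subtype_val
  continuousOn_toFun := (𝓡∂ 2).continuous_symm.comp_continuousOn
    (Θ.continuousOn.comp continuous_subtype_val.continuousOn fun _ h => h)
  continuousOn_invFun := (𝓡∂ 2).continuous_symm.comp_continuousOn
    (Θ.continuousOn_symm.comp continuous_subtype_val.continuousOn fun _ h => h)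

section halfPlaneHomeo

variable (Θ : OpenPartialHomeomorph Plane Plane) (hs : ∀ y ∈ Θ.source, 0 < y 0)
  (ht : ∀ y ∈ Θ.target, 0 < y 0)

lemma halfPlaneHomeo_val {y : HalfPlane} (hy : y.1 ∈ Θ.source) :
    (halfPlaneHomeo Θ hs ht y).1 = Θ y.1 :=
  I_symm_val (mem_range_I.2 (ht _ (Θ.map_source hy)).le)

lemma halfPlaneHomeo_symm_val {y : HalfPlane} (hy : y.1 ∈ Θ.target) :
    ((halfPlaneHomeo Θ hs ht).symm y).1 = Θ.symm y.1 :=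
  I_symm_val (mem_range_I.2 (hs _ (Θ.map_target hy)).le)

lemma halfPlaneHomeo_mem_contDiffGroupoid (h1 : ContDiffOn ℝ ∞ Θ Θ.source)
    (h2 : ContDiffOn ℝ ∞ Θ.symm Θ.target) :
    halfPlaneHomeo Θ hs ht ∈ contDiffGroupoid ∞ (𝓡∂ 2) := by
  refine mem_groupoid_of_pregroupoid.2 ⟨?_, ?_⟩
  · refine (h1.mono (fun z hz => ?_)).congr (fun z hz => ?_)
    · rw [← I_symm_val hz.2]; exact hz.1
    · change (halfPlaneHomeo Θ hs ht _).1 = _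
      rw [halfPlaneHomeo_val Θ hs ht hz.1, I_symm_val hz.2]
  · refine (h2.mono (fun z hz => ?_)).congr (fun z hz => ?_)
    · rw [← I_symm_val hz.2]; exact hz.1
    · change ((halfPlaneHomeo Θ hs ht).symm _).1 = _
      rw [halfPlaneHomeo_symm_val Θ hs ht hz.1, I_symm_val hz.2]

end halfPlaneHomeo

lemma det_plane (A : Plane →L[ℝ] Plane) : A.det = cross (A !₂[1, 0]) (A !₂[0, 1]) := by
  let b := (EuclideanSpace.basisFun (Fin 2) ℝ).toBasis
  have hb0 : b 0 = !₂[1, 0] := by ext i; fin_cases i <;> simp [b]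
  have hb1 : b 1 = !₂[0, 1] := by ext i; fin_cases i <;> simp [b]
  rw [ContinuousLinearMap.det, ← LinearMap.det_toMatrix b, Matrix.det_fin_two]
  simp only [LinearMap.toMatrix_apply, hb0, hb1, cross]
  simp [b]
  ring

variable [hT : Fact (0 < T)]

/-- A chart of the atlas, shrunk into `N`. It is the version that also works at boundary points,
where the inverse function theorem is not available. -/
lemma exists_isLocalForm_crd (σ : Bool) {p : ℝ × ℝ} (hp : p ∈ strip T) (hpσ : crd T σ p 0 < T)
    {N : Set (ℝ × ℝ)} (hN : N ∈ 𝓝 p) :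
    ∃ e : OpenPartialHomeomorph (Cyl T) HalfPlane, IsLocalForm e (crd T σ) N ∧
      cover p ∈ e.source := by
  have hs : IsOpen {y : HalfPlane | crdInv T σ y.1 ∈ interior N} :=
    isOpen_interior.preimage ((contDiff_crdInv σ).continuous.comp continuous_subtype_val)
  refine ⟨chart (branch p.1) (branch_eq p.1) σ ≫ₕ OpenPartialHomeomorph.ofSet _ hs,
    isLocalForm_trans p.1 σ (ofSet_mem_contDiffGroupoid hs) (fun y hy => ?_)
      ((contDiff_crd σ).differentiable (by simp)) (fun y hy => ?_), ?_⟩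
  · refine ⟨ContinuousLinearMap.id ℝ Plane, by simp [ContinuousLinearMap.det], ?_⟩
    exact (hasFDerivWithinAt_id _ _).congr (fun z hz => I_symm_val hz)
      (I_symm_val (mem_range_self y))
  · exact ⟨interior_subset hy, by simp⟩
  · have h1 : (cover p : Cyl T) ∈ (chart (branch p.1) (branch_eq p.1) σ).source := by
      rw [mem_chart_source, cover_eq hp]
      refine ⟨exp_mem_branch p.1, ?_⟩
      rw [crd_zero] at hpσ ⊢; exact hpσ
    refine ⟨h1, ?_⟩
    change crdInv T σ (chart (branch p.1) (branch_eq p.1) σ (cover p)).1 ∈ interior N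
    rw [chart_val, crdInv_crd, cover_eq hp, ← branch_eq p.1,
      (branch p.1).left_inv (mem_branch p.1)]
    exact mem_interior_iff_mem_nhds.2 hN

/-- A smooth map with positive Jacobian determinant is, near an interior point, the local form of an
oriented chart. -/
lemma exists_isLocalForm {p : ℝ × ℝ} (hp : p.2 ∈ Ioo 0 T) {Ψ : ℝ × ℝ → Plane}
    (hΨ : ContDiff ℝ ∞ Ψ) (hp0 : 0 < Ψ p 0)
    (hd : 0 < cross (fderiv ℝ Ψ p (1, 0)) (fderiv ℝ Ψ p (0, 1)))
    {N : Set (ℝ × ℝ)} (hN : N ∈ 𝓝 p) :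
    ∃ e : OpenPartialHomeomorph (Cyl T) HalfPlane, IsLocalForm e Ψ N ∧ cover p ∈ e.source := by
  have hps : p ∈ strip T := mem_strip.2 (Ioo_subset_Icc_self hp)
  set F : Plane → Plane := Ψ ∘ crdInv T true with hF
  have hFs : ContDiff ℝ ∞ F := hΨ.comp (contDiff_crdInv true)
  have hFd : ∀ y, HasFDerivAt F (fderiv ℝ F y) y := fun y =>
    (hFs.differentiable (by simp) y).hasFDerivAt
  set y₀ : Plane := crd T true p with hy₀
  have hdet : 0 < (fderiv ℝ F y₀).det := by
    have h1 : fderiv ℝ F y₀ = fderiv ℝ Ψ p ∘L (rot.symm : Plane →L[ℝ] (ℝ × ℝ)) := by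
      have h2 := HasFDerivAt.comp (g := Ψ) y₀ (hΨ.differentiable (by simp) _).hasFDerivAt
        (hasFDerivAt_crdInv (T := T) true y₀)
      rw [hF, h2.fderiv, hy₀, crdInv_crd]
      ext v; simp [sg]
    rw [det_plane, h1]
    have h3 : (rot.symm : Plane →L[ℝ] (ℝ × ℝ)) !₂[1, 0] = (0, 1) := by simp
    have h4 : (rot.symm : Plane →L[ℝ] (ℝ × ℝ)) !₂[0, 1] = -(1, 0) := by simp
    simp only [ContinuousLinearMap.comp_apply, h3, h4, map_neg]
    simp only [cross, PiLp.neg_apply] at hd ⊢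
    linarith
  have hc : ContDiffAt ℝ ∞ F y₀ := hFs.contDiffAt
  have hd0 : HasFDerivAt F
      ((fderiv ℝ F y₀).toContinuousLinearEquivOfDetNeZero hdet.ne' : Plane →L[ℝ] Plane) y₀ := by
    rw [ContinuousLinearMap.coe_toContinuousLinearEquivOfDetNeZero]; exact hFd y₀
  -- The local inverse is restricted so that source and image lie in the open half-plane, the source
  -- is covered by `N`, and the Jacobian determinant is positive throughout.
  set W : Set Plane := {y | 0 < y 0} ∩ crdInv T true ⁻¹' interior N ∩ {y | 0 < F y 0} ∩
    {y | 0 < (fderiv ℝ F y).det} with hW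
  have hWo : IsOpen W := by
    have h0 : Continuous fun z : Plane => z 0 := by fun_prop
    refine (((isOpen_lt continuous_const h0).inter
      (isOpen_interior.preimage (contDiff_crdInv true).continuous)).inter
      (isOpen_lt continuous_const (h0.comp hFs.continuous))).inter
      (isOpen_lt continuous_const ?_)
    exact ContinuousLinearMap.continuous_det.comp (hFs.continuous_fderiv (by simp))
  set Θ₀ := hc.toOpenPartialHomeomorph F hd0 (by simp) with hΘ₀
  have hΘ₀F : ⇑Θ₀ = F := rfl
  set Θ := Θ₀.restrOpen W hWo with hΘ
  have hΘF : ⇑Θ = F := rfl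
  have hΘs : Θ.source = Θ₀.source ∩ W := rfl
  have hΘW : ∀ y ∈ Θ.source, y ∈ W := fun y hy => hy.2
  have hs : ∀ y ∈ Θ.source, 0 < y 0 := fun y hy => (hΘW y hy).1.1.1
  have ht : ∀ y ∈ Θ.target, 0 < y 0 := fun y hy => by
    have := (hΘW _ (Θ.map_target hy)).1.2
    rw [mem_ofPred_eq, ← hΘF, Θ.right_inv hy] at this
    exact this
  have hder : ∀ y ∈ Θ.target, ∃ A : Plane ≃L[ℝ] Plane, 0 < (A : Plane →L[ℝ] Plane).det ∧
      HasFDerivAt Θ (A : Plane →L[ℝ] Plane) (Θ.symm y) := fun y hy => by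
    have h1 : 0 < (fderiv ℝ F (Θ.symm y)).det := (hΘW _ (Θ.map_target hy)).2
    refine ⟨(fderiv ℝ F (Θ.symm y)).toContinuousLinearEquivOfDetNeZero h1.ne', ?_, ?_⟩ <;>
      rw [ContinuousLinearMap.coe_toContinuousLinearEquivOfDetNeZero]
    · exact h1
    · exact hFd _
  refine ⟨chart (branch p.1) (branch_eq p.1) true ≫ₕ halfPlaneHomeo Θ hs ht,
    isLocalForm_trans p.1 true (halfPlaneHomeo_mem_contDiffGroupoid Θ hs ht hFs.contDiffOn ?_)
      (fun y hy => ?_) (hΨ.differentiable (by simp)) (fun y hy => ?_), ?_⟩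
  · intro y hy
    obtain ⟨A, -, hA⟩ := hder y hy
    exact (Θ.contDiffAt_symm hy hA hFs.contDiffAt).contDiffWithinAt
  · obtain ⟨A, hA0, hA⟩ := hder y.1 hy
    refine ⟨A.symm, ?_, ?_⟩
    · have h1 : (A : Plane →L[ℝ] Plane).det * (A.symm : Plane →L[ℝ] Plane).det = 1 := by
        have := LinearMap.det_comp (A : Plane →ₗ[ℝ] Plane) (A.symm : Plane →ₗ[ℝ] Plane)
        rw [ContinuousLinearMap.det, ContinuousLinearMap.det]
        refine this.symm.trans ?_
        have h2 : (A : Plane →ₗ[ℝ] Plane) ∘ₗ (A.symm : Plane →ₗ[ℝ] Plane) = LinearMap.id := by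
          ext v; simp
        rw [h2, LinearMap.det_id]
      exact pos_of_mul_pos_right (by rw [h1]; exact one_pos) hA0.le
    · have h1 := (Θ.hasFDerivAt_symm hy hA).hasFDerivWithinAt (s := range (𝓡∂ 2))
      have h2 : ∀ z ∈ range (𝓡∂ 2) ∩ Θ.target,
          ((halfPlaneHomeo Θ hs ht).symm ((𝓡∂ 2).symm z)).1 = Θ.symm z := fun z hz => by
        rw [halfPlaneHomeo_symm_val Θ hs ht (by rw [I_symm_val hz.1]; exact hz.2), I_symm_val hz.1]
      refine h1.congr_of_eventuallyEq ?_ (h2 y.1 ⟨mem_range_self y, hy⟩)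
      filter_upwards [self_mem_nhdsWithin, nhdsWithin_le_nhds (Θ.open_target.mem_nhds hy)]
        with z hz1 hz2 using h2 z ⟨hz1, hz2⟩
  · exact ⟨interior_subset (hΘW _ hy).1.1.2, halfPlaneHomeo_val Θ hs ht hy⟩
  · have h1 : (cover p : Cyl T) ∈ (chart (branch p.1) (branch_eq p.1) true).source := by
      rw [mem_chart_source, cover_eq hps]
      refine ⟨exp_mem_branch p.1, ?_⟩
      rw [crd_zero]; exact hp.2
    refine ⟨h1, ?_⟩
    change (chart (branch p.1) (branch_eq p.1) true (cover p)).1 ∈ Θ.source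
    have h2 : (chart (branch p.1) (branch_eq p.1) true (cover p : Cyl T)).1 = y₀ := by
      rw [chart_val, cover_eq hps, ← branch_eq p.1, (branch p.1).left_inv (mem_branch p.1)]
    rw [h2]
    refine ⟨hc.mem_toOpenPartialHomeomorph_source hd0 (by simp), ⟨⟨?_, ?_⟩, ?_⟩, hdet⟩
    · change 0 < crd T true p 0
      rw [crd_zero]; exact hp.1
    · change crdInv T true (crd T true p) ∈ interior N
      rw [crdInv_crd]; exact mem_interior_iff_mem_nhds.2 hN
    · change 0 < Ψ (crdInv T true (crd T true p)) 0
      rw [crdInv_crd]; exact hp0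

end Cyl

/-! ### The boundary, the height function and the distinguished points. -/

namespace Cyl

variable {T : ℝ}

lemma hasFDerivAt_snd_div (p : ℝ × ℝ) :
    HasFDerivAt (fun p : ℝ × ℝ => p.2 / T) (T⁻¹ • ContinuousLinearMap.snd ℝ ℝ ℝ) p := by
  have := (hasFDerivAt_snd (𝕜 := ℝ) (p := p)).const_smul T⁻¹
  refine this.congr_of_eventuallyEq (Filter.Eventually.of_forall fun z => ?_)
  simp [div_eq_inv_mul]

lemma isPreconnected_level (t : Icc (0 : ℝ) T) : IsPreconnected {q : Cyl T | q.2 = t} := by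
  have h : {q : Cyl T | q.2 = t} = (fun z : ℝ => (Circle.exp z, t)) '' univ := by
    ext q
    simp only [mem_ofPred_eq, image_univ, mem_range]
    exact ⟨fun h => ⟨Complex.arg q.1, Prod.ext (Circle.exp_arg _) h.symm⟩,
      fun ⟨z, hz⟩ => by rw [← hz]⟩
  rw [h]
  exact isPreconnected_univ.image _ (by fun_prop)

/-- The line over the distinguished point of the circle. -/
def baseLine (T : ℝ) : Set (Cyl T) := {q | q.1 = Circle.exp Real.pi}

lemma isPreconnected_baseLine : IsPreconnected (baseLine T) := by
  have h : baseLine T = (fun t : Icc (0 : ℝ) T => (Circle.exp Real.pi, t)) '' univ := by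
    ext q
    simp only [image_univ, mem_range]
    exact ⟨fun h => ⟨q.2, Prod.ext (Eq.symm h) rfl⟩, fun ⟨z, hz⟩ => by rw [← hz]; rfl⟩
  rw [h]
  have : PreconnectedSpace (Icc (0 : ℝ) T) := Subtype.preconnectedSpace isPreconnected_Icc
  exact isPreconnected_univ.image _ (by fun_prop)

variable [hT : Fact (0 < T)]

lemma extChartAt_self_zero (q : Cyl T) :
    extChartAt (𝓡∂ 2) q q 0 = if (q.2 : ℝ) < T then (q.2 : ℝ) else T - q.2 := by
  obtain ⟨x, -, h⟩ := extChartAt_self q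
  rw [h, crd_zero]
  simp [side]

lemma boundary_eq : (𝓡∂ 2).boundary (Cyl T) = {q | (q.2 : ℝ) = 0 ∨ (q.2 : ℝ) = T} := by
  ext q
  change (𝓡∂ 2).IsBoundaryPoint q ↔ _
  rw [ModelWithCorners.isBoundaryPoint_iff, frontier_range_modelWithCornersEuclideanHalfSpace]
  change (0 : ℝ) = extChartAt (𝓡∂ 2) q q 0 ↔ _
  rw [extChartAt_self_zero, mem_ofPred_eq]
  have h1 := q.2.2.2
  split_ifs with h
  · exact ⟨fun h => Or.inl h.symm, fun h' => (h'.resolve_right h.ne).symm⟩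
  · have : (q.2 : ℝ) = T := le_antisymm h1 (not_lt.1 h)
    simp [this]

lemma isInteriorPoint {q : Cyl T} (h0 : 0 < (q.2 : ℝ)) (h1 : (q.2 : ℝ) < T) :
    (𝓡∂ 2).IsInteriorPoint q := by
  by_contra h
  have h2 : q ∈ (𝓡∂ 2).boundary (Cyl T) := by
    rwa [← ModelWithCorners.compl_interior]
  rw [boundary_eq] at h2
  rcases h2 with h2 | h2 <;> linarith

/-- The projection to `[0, 1]`. -/
noncomputable def height (q : Cyl T) : ℝ := q.2 / T

lemma height_cover {p : ℝ × ℝ} (hp : p ∈ strip T) : height (cover p : Cyl T) = p.2 / T := by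
  rw [cover_eq hp]; rfl

lemma height_eventually {p : ℝ × ℝ} :
    ∀ᶠ z in 𝓝[strip T] p, height (cover z : Cyl T) = z.2 / T := by
  filter_upwards [self_mem_nhdsWithin] with z hz using height_cover hz

lemma contMDiff_height : ContMDiff (𝓡∂ 2) 𝓘(ℝ, ℝ) ∞ (height : Cyl T → ℝ) := by
  intro q
  rw [contMDiffAt_iff]
  have hp : (Complex.arg q.1, (q.2 : ℝ)) ∈ strip T := by simp
  obtain ⟨k, h0, ht, hs⟩ := preferred_coordinates hp (cover_surj q).symm
  refine ⟨(by unfold height; fun_prop : Continuous (height : Cyl T → ℝ)).continuousAt, ?_⟩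
  have h1 : ContDiff ℝ ∞ fun z : Plane => (crdInv T (side q) z + (k, 0)).2 / T :=
    (contDiff_snd.comp ((contDiff_crdInv _).add contDiff_const)).div_const T
  refine h1.contDiffAt.contDiffWithinAt.congr_of_eventuallyEq_of_mem ?_ (mem_range_self _)
  filter_upwards [ht.eventually height_eventually, self_mem_nhdsWithin] with z hz hz'
  rw [← hz, ← hs z hz']
  rfl

lemma mfderiv_height_ne_zero (q : Cyl T) : mfderiv (𝓡∂ 2) 𝓘(ℝ, ℝ) height q ≠ 0 := by
  have hp : (Complex.arg q.1, (q.2 : ℝ)) ∈ strip T := by simp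
  have h := hasFDerivWithinAt_preferred hp (cover_surj q).symm
    (hasFDerivAt_snd_div _).differentiableAt height_eventually
  rw [(contMDiff_height q |>.mdifferentiableAt (by simp)).mfderiv]
  have h2 : writtenInExtChartAt (𝓡∂ 2) 𝓘(ℝ, ℝ) q (height : Cyl T → ℝ)
      = height ∘ (extChartAt (𝓡∂ 2) q).symm := rfl
  rw [h2, h.fderivWithin ((𝓡∂ 2).uniqueDiffOn _ (mem_range_self _)),
    (hasFDerivAt_snd_div _).fderiv]
  intro h3
  have h4 : ((T⁻¹ • ContinuousLinearMap.snd ℝ ℝ ℝ) ∘L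
      (sg (side q) • (rot.symm : Plane →L[ℝ] (ℝ × ℝ)))) (sg (side q) • rot (0, 1)) = 0 :=
    congrArg (fun L : Plane →L[ℝ] ℝ => L (sg (side q) • rot (0, 1))) h3
  have h5 := hT.out.ne'
  cases hs : side q <;> simp [hs, sg, h5] at h4

lemma isHeightFunction_height {A B : Set (Cyl T)} (hA : A = {q | (q.2 : ℝ) = 0})
    (hB : B = {q | (q.2 : ℝ) = T}) : IsHeightFunction (height : Cyl T → ℝ) A B where
  smooth := contMDiff_height
  mem_Icc q := ⟨div_nonneg q.2.2.1 hT.out.le, div_le_one_of_le₀ q.2.2.2 hT.out.le⟩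
  zero := by
    have := hT.out.ne'
    ext q; simp [height, hA, this]
  one := by
    have := hT.out.ne'
    ext q; simp [height, hB, div_eq_one_iff_eq this]
  boundary_regular q _ := mfderiv_height_ne_zero q
  -- There are no critical points, so the Morse condition is vacuous.
  nondegenerate q h := absurd h (mfderiv_height_ne_zero q)

/-- Every nonempty level set is a single circle, and it meets the line over `-1` once. Genericity of
the cross-section plays no role. -/
lemma existsUnique_base (t : ℝ) (q : Cyl T) (hq : q ∈ height ⁻¹' {t}) :
    ∃! b, b ∈ baseLine T ∧ b ∈ connectedComponentIn (height ⁻¹' {t}) q := by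
  have h0 := hT.out.ne'
  have h : height ⁻¹' {t} = {q' : Cyl T | q'.2 = q.2} := by
    have h1 : height q = t := hq
    ext q'
    simp only [mem_preimage, mem_singleton_iff, ← h1, height, mem_ofPred_eq, Subtype.ext_iff]
    rw [div_left_inj' h0]
  rw [h, (isPreconnected_level q.2).connectedComponentIn rfl]
  exact ⟨(Circle.exp Real.pi, q.2), ⟨rfl, rfl⟩, fun b hb => Prod.ext hb.1 hb.2⟩

end Cyl

/-! ## Planar patterns of defects -/

/-- The value of a planar pattern at a point: a region, a wall with its direction, or a vertex. -/
inductive Mark {B : Type*} (R : Set (List (B × Bool)))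
  | region
  | wall (b : B) (v : ℝ × ℝ)
  | vertex (u : R × Bool)

/-- A planar pattern of defects. -/
abbrev Pattern {B : Type*} (R : Set (List (B × Bool))) := ℝ × ℝ → Mark R

namespace Pattern

open Cyl (sg)

variable {B : Type*} {R : Set (List (B × Bool))}

/-- The tangent direction of the level sets of `g`, with larger values of `g` on the left. -/
noncomputable def tangent (g : ℝ × ℝ → ℝ) (q : ℝ × ℝ) : ℝ × ℝ :=
  (fderiv ℝ g q (0, 1), -fderiv ℝ g q (1, 0))

open Classical in
/-- The zero set of `g` as a wall. -/
noncomputable def curve (R : Set (List (B × Bool))) (g : ℝ × ℝ → ℝ) (b : B) : Pattern R := fun q =>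
  if g q = 0 then .wall b (tangent g q) else .region

/-- `q` lies on the ray of slope `1 / a` which goes upwards from `p`. -/
def OnRay (p : ℝ × ℝ) (a : ℝ) (q : ℝ × ℝ) : Prop := p.2 < q.2 ∧ q.1 - p.1 = a * (q.2 - p.2)

/-- The pattern `P` is locally cone-like at `p`. -/
inductive Good (P : Pattern R) (p : ℝ × ℝ) : Prop
  | region (h : ∀ᶠ q in 𝓝 p, P q = .region)
  | wall (g : ℝ × ℝ → ℝ) (b : B) (hg : ContDiff ℝ ∞ g) (h0 : g p = 0) (h1 : fderiv ℝ g p ≠ 0)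
      (h : ∀ᶠ q in 𝓝 p, P q = curve R g b q)
  -- All branches go up from `p`, so decreasing `a` means counterclockwise order. Letters are read
  -- towards `p`, that is downwards, which accounts for the minus signs in the direction of the
  -- wall.
  | vertex (u : R × Bool) (w : List (B × Bool)) (a : Fin w.length → ℝ)
      (hu : (presentationDefectData R).ψ₀₁ u = (w : Cycle (B × Bool))) (ha : StrictAnti a)
      (hp : P p = .vertex u)
      (h : ∀ᶠ q in 𝓝 p, q ≠ p → (P q = .region ∧ ∀ k, ¬ OnRay p (a k) q) ∨
        ∃ k, OnRay p (a k) q ∧ P q = .wall (w.get k).1 (-sg (w.get k).2 * a k, -sg (w.get k).2))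

lemma Good.congr {P Q : Pattern R} {p : ℝ × ℝ} (hP : Good P p) (h : ∀ᶠ q in 𝓝 p, Q q = P q) :
    Good Q p := by
  cases hP with
  | region h' => exact .region (by filter_upwards [h, h'] with q h1 h2 using h1.trans h2)
  | wall g b hg h0 h1 h' =>
    exact .wall g b hg h0 h1 (by filter_upwards [h, h'] with q h1 h2 using h1.trans h2)
  | vertex u w a hu ha hp h' =>
    refine .vertex u w a hu ha (h.self_of_nhds.trans hp) ?_
    filter_upwards [h, h'] with q h1 h2
    rw [h1]; exact h2

lemma Good.eventually_region {P : Pattern R} {p : ℝ × ℝ} (hP : Good P p) (h : P p = .region) :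
    ∀ᶠ q in 𝓝 p, P q = .region := by
  cases hP with
  | region h' => exact h'
  | wall g b hg h0 h1 h' =>
    have h2 := h'.self_of_nhds
    simp [curve, h0, h] at h2
  | vertex u w a hu ha hp h' => simp [h] at hp

lemma tangent_sub (g : ℝ × ℝ → ℝ) (v q : ℝ × ℝ) :
    tangent (fun q => g (q - v)) q = tangent g (q - v) := by
  simp only [tangent, fderiv_comp_sub]

lemma Good.translate {P : Pattern R} {p : ℝ × ℝ} (v : ℝ × ℝ) (hP : Good P (p - v)) :
    Good (fun q => P (q - v)) p := by
  have hc : Filter.Tendsto (fun q => q - v) (𝓝 p) (𝓝 (p - v)) :=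
    (continuous_id.sub continuous_const).tendsto p
  cases hP with
  | region h' => exact .region (hc.eventually h')
  | wall g b hg h0 h1 h' =>
    refine .wall (fun q => g (q - v)) b (hg.comp (contDiff_id.sub contDiff_const)) h0
      (by rwa [fderiv_comp_sub]) ?_
    filter_upwards [hc.eventually h'] with q hq
    rw [hq, curve, curve, tangent_sub]
  | vertex u w a hu ha hp h' =>
    refine .vertex u w a hu ha hp ?_
    filter_upwards [hc.eventually h'] with q hq hqp
    have := hq (fun h => hqp (sub_left_injective h))
    simpa [OnRay] using this

/-! ### Superposition of patterns. -/

/-- The superposition of two patterns. -/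
def overlay (P Q : Pattern R) : Pattern R := fun q =>
  match P q with
  | .region => Q q
  | .wall b v => .wall b v
  | .vertex u => .vertex u

lemma overlay_of_region {P Q : Pattern R} {q : ℝ × ℝ} (h : P q = .region) :
    overlay P Q q = Q q := by simp [overlay, h]

lemma overlay_of_ne {P Q : Pattern R} {q : ℝ × ℝ} (h : P q ≠ .region) :
    overlay P Q q = P q := by
  unfold overlay; split <;> simp_all

lemma overlay_of_region_right {P Q : Pattern R} {q : ℝ × ℝ} (h : Q q = .region) :
    overlay P Q q = P q := by
  by_cases h' : P q = .region
  · rw [overlay_of_region h', h, h']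
  · exact overlay_of_ne h'

lemma overlay_eq_region {P Q : Pattern R} {q : ℝ × ℝ} :
    overlay P Q q = .region ↔ P q = .region ∧ Q q = .region := by
  by_cases h' : P q = .region
  · simp [overlay_of_region h', h']
  · simp [overlay_of_ne h', h']

/-- Regions are open, so near `p` one of the two patterns is empty and the superposition is just the
other one. -/
lemma Good.overlay {P Q : Pattern R} {p : ℝ × ℝ} (hP : Good P p) (hQ : Good Q p)
    (h : P p = .region ∨ Q p = .region) : Good (overlay P Q) p := by
  rcases h with h | h
  · refine hQ.congr ?_
    filter_upwards [hP.eventually_region h] with q hq using overlay_of_region hq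
  · refine hP.congr ?_
    filter_upwards [hQ.eventually_region h] with q hq using overlay_of_region_right hq

/-- The superposition of a list of patterns. -/
def superpose : List (Pattern R) → Pattern R
  | [] => fun _ => .region
  | P :: Ps => overlay P (superpose Ps)

lemma superpose_append (Ps Qs : List (Pattern R)) (q : ℝ × ℝ) :
    superpose (Ps ++ Qs) q = overlay (superpose Ps) (superpose Qs) q := by
  induction Ps with
  | nil => rw [overlay_of_region rfl]; rfl
  | cons P Ps ih =>
    simp only [List.cons_append, superpose]
    by_cases h : P q = .region
    · rw [overlay_of_region h, ih]
      by_cases h' : superpose Ps q = .region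
      · rw [overlay_of_region h', overlay_of_region (overlay_eq_region.2 ⟨h, h'⟩)]
      · rw [overlay_of_ne h', overlay_of_ne (by rwa [overlay_of_region h]), overlay_of_region h]
    · rw [overlay_of_ne h, overlay_of_ne (by rwa [overlay_of_ne h]), overlay_of_ne h]

lemma superpose_eq_region {Ps : List (Pattern R)} {q : ℝ × ℝ} :
    superpose Ps q = .region ↔ ∀ P ∈ Ps, P q = .region := by
  induction Ps with
  | nil => simp [superpose]
  | cons P Ps ih => simp [superpose, overlay_eq_region, ih]

lemma superpose_eq_of_ne {Ps : List (Pattern R)} {q : ℝ × ℝ} (h : superpose Ps q ≠ .region) :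
    ∃ P ∈ Ps, P q ≠ .region ∧ superpose Ps q = P q := by
  induction Ps with
  | nil => simp [superpose] at h
  | cons P Ps ih =>
    by_cases h' : P q = .region
    · simp only [superpose] at h ⊢
      rw [overlay_of_region h'] at h ⊢
      obtain ⟨Q, hQ, h1⟩ := ih h
      exact ⟨Q, List.mem_cons_of_mem _ hQ, h1⟩
    · exact ⟨P, List.mem_cons_self, h', overlay_of_ne h'⟩

lemma superpose_map_congr {α : Type*} {l : List α} {F G : α → Pattern R} {q : ℝ × ℝ}
    (h : ∀ x ∈ l, F x q = G x q) : superpose (l.map F) q = superpose (l.map G) q := by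
  induction l with
  | nil => rfl
  | cons x l ih =>
    simp only [List.map_cons, superpose, overlay, h x List.mem_cons_self,
      ih fun y hy => h y (List.mem_cons_of_mem _ hy)]

lemma good_superpose {Ps : List (Pattern R)} {p : ℝ × ℝ} (h : ∀ P ∈ Ps, Good P p)
    (h' : Ps.Pairwise fun P Q => P p = .region ∨ Q p = .region) : Good (superpose Ps) p := by
  induction Ps with
  | nil => exact .region (Filter.Eventually.of_forall fun _ => rfl)
  | cons P Ps ih =>
    rw [List.pairwise_cons] at h'
    refine (h P List.mem_cons_self).overlay
      (ih (fun Q hQ => h Q (List.mem_cons_of_mem _ hQ)) h'.2) ?_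
    by_cases hP : P p = .region
    · exact Or.inl hP
    · exact Or.inr (superpose_eq_region.2 fun Q hQ => (h'.1 Q hQ).resolve_left hP)

/-- A regular zero set is a wall, and off its zeros a continuous function stays nonzero. -/
lemma good_curve {g : ℝ × ℝ → ℝ} (hg : ContDiff ℝ ∞ g) (b : B) {p : ℝ × ℝ}
    (h : g p = 0 → fderiv ℝ g p ≠ 0) : Good (curve R g b) p := by
  by_cases h0 : g p = 0
  · exact .wall g b hg h0 (h h0) (Filter.Eventually.of_forall fun _ => rfl)
  · refine .region ?_
    filter_upwards [hg.continuous.continuousAt.eventually_ne h0] with q hq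
    simp [curve, hq]

/-! ### Graphs -/

/-- The graph `x = c t` as a wall, whose label is `l` when read upwards. -/
noncomputable def graph (R : Set (List (B × Bool))) (c : ℝ → ℝ) (l : B × Bool) : Pattern R :=
  curve R (fun q => sg l.2 * (c q.2 - q.1)) l.1

lemma sg_ne_zero (ε : Bool) : sg ε ≠ 0 := by cases ε <;> simp [sg]

lemma hasFDerivAt_graph {c : ℝ → ℝ} {c' : ℝ} {q : ℝ × ℝ} (hc : HasDerivAt c c' q.2) (s : ℝ) :
    HasFDerivAt (fun q : ℝ × ℝ => s * (c q.2 - q.1))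
      (s • (c' • ContinuousLinearMap.snd ℝ ℝ ℝ - ContinuousLinearMap.fst ℝ ℝ ℝ)) q :=
  ((hc.comp_hasFDerivAt q hasFDerivAt_snd).sub hasFDerivAt_fst).const_mul s

open Classical in
lemma graph_apply {c : ℝ → ℝ} {c' : ℝ} {q : ℝ × ℝ} (hc : HasDerivAt c c' q.2) (l : B × Bool) :
    graph R c l q = if q.1 = c q.2 then .wall l.1 (sg l.2 * c', sg l.2) else .region := by
  have h := (hasFDerivAt_graph hc (sg l.2)).fderiv
  simp only [graph, curve, tangent, h]
  have : sg l.2 * (c q.2 - q.1) = 0 ↔ q.1 = c q.2 := by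
    simp [sg_ne_zero, sub_eq_zero, eq_comm]
  simp [this]

lemma graph_eq_region {c : ℝ → ℝ} {l : B × Bool} {q : ℝ × ℝ} (h : q.1 ≠ c q.2) :
    graph R c l q = .region := by
  have : sg l.2 * (c q.2 - q.1) ≠ 0 := mul_ne_zero (sg_ne_zero _) (sub_ne_zero.2 h.symm)
  simp only [graph, curve, if_neg this]

lemma good_graph {c : ℝ → ℝ} (hc : ContDiff ℝ ∞ c) (l : B × Bool) (p : ℝ × ℝ) :
    Good (graph R c l) p := by
  refine good_curve ?_ _ fun _ => ?_
  · exact contDiff_const.mul ((hc.comp contDiff_snd).sub contDiff_fst)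
  · rw [(hasFDerivAt_graph (hc.differentiable (by simp) _).hasDerivAt (sg l.2)).fderiv]
    intro h
    have := congrArg (fun L : ℝ × ℝ →L[ℝ] ℝ => L (1, 0)) h
    simp [sg_ne_zero] at this

/-- Two graphs can meet at `p` only if their functions agree at the height of `p`, so that single
height has to be checked. -/
lemma good_superpose_graph {α : Type*} (l : List α) (c : α → ℝ → ℝ) (hc : ∀ x, ContDiff ℝ ∞ (c x))
    (lab : α → B × Bool) (p : ℝ × ℝ) (h : l.Pairwise fun x y => c x p.2 ≠ c y p.2) :
    Good (superpose (l.map fun x => graph R (c x) (lab x))) p := by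
  refine good_superpose (fun P hP => ?_) (List.pairwise_map.2 (h.imp fun {x y} hxy => ?_))
  · obtain ⟨x, -, rfl⟩ := List.mem_map.1 hP
    exact good_graph (hc x) _ _
  · by_cases hx : p.1 = c x p.2
    · exact Or.inr (graph_eq_region (by rw [hx]; exact hxy))
    · exact Or.inl (graph_eq_region hx)

/-! ### Vertical lines -/

/-- The pattern of vertical lines at given positions and with given labels. -/
noncomputable def lines (R : Set (List (B × Bool))) (L : List (ℝ × (B × Bool))) : Pattern R :=
  superpose (L.map fun x => graph R (fun _ => x.1) x.2)

/-- The positions of the labels increase strictly and lie in `(-π, π)`. -/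
structure IsConfig (L : List (ℝ × (B × Bool))) : Prop where
  sorted : L.Pairwise fun x y => x.1 < y.1
  mem : ∀ x ∈ L, x.1 ∈ Ioo (-Real.pi) Real.pi

open Classical in
lemma line_apply (x : ℝ) (l : B × Bool) (q : ℝ × ℝ) :
    graph R (fun _ => x) l q = if q.1 = x then .wall l.1 (0, sg l.2) else .region := by
  rw [graph_apply (hasDerivAt_const _ _), mul_zero]

lemma lines_congr (L : List (ℝ × (B × Bool))) {q q' : ℝ × ℝ} (h : q.1 = q'.1) :
    lines R L q = lines R L q' := by
  unfold lines
  induction L with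
  | nil => rfl
  | cons x L ih => simp only [List.map_cons, superpose, overlay, ih, line_apply, h]

lemma lines_eq_region {L : List (ℝ × (B × Bool))} {q : ℝ × ℝ} (h : ∀ x ∈ L, x.1 ≠ q.1) :
    lines R L q = .region := by
  refine superpose_eq_region.2 fun P hP => ?_
  obtain ⟨x, hx, rfl⟩ := List.mem_map.1 hP
  exact graph_eq_region (h x hx).symm

lemma exists_of_lines_ne {L : List (ℝ × (B × Bool))} {q : ℝ × ℝ} (h : lines R L q ≠ .region) :
    ∃ x ∈ L, x.1 = q.1 := by
  by_contra! h'
  exact h (lines_eq_region h')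

lemma lines_of_mem {L : List (ℝ × (B × Bool))} (hL : IsConfig L) {x : ℝ × (B × Bool)} (hx : x ∈ L)
    {q : ℝ × ℝ} (hq : q.1 = x.1) : lines R L q = .wall x.2.1 (0, sg x.2.2) := by
  have h1 : lines R L q ≠ .region := by
    rw [lines, Ne, superpose_eq_region]
    push Not
    refine ⟨_, List.mem_map.2 ⟨x, hx, rfl⟩, ?_⟩
    rw [line_apply, if_pos hq]
    simp
  obtain ⟨P, hP, h2, h3⟩ := superpose_eq_of_ne h1
  obtain ⟨y, hy, rfl⟩ := List.mem_map.1 hP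
  rw [lines, h3]
  simp only [line_apply] at h2 ⊢
  have h4 : q.1 = y.1 := by
    by_contra h; simp [h] at h2
  have h5 : x = y := by
    by_contra hne
    have : Std.Symm fun a b : ℝ × (B × Bool) => a.1 ≠ b.1 := ⟨fun _ _ h => h.symm⟩
    have h6 := (hL.sorted.imp (S := fun a b => a.1 ≠ b.1) fun h => h.ne).forall hx hy hne
    exact h6 (hq.symm.trans h4)
  rw [if_pos h4, h5]

lemma good_lines {L : List (ℝ × (B × Bool))} (hL : IsConfig L) (p : ℝ × ℝ) :
    Good (lines R L) p :=
  good_superpose_graph L (fun x _ => x.1) (fun _ => contDiff_const) _ p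
    (hL.sorted.imp fun h => h.ne)

lemma lines_append (L L' : List (ℝ × (B × Bool))) (q : ℝ × ℝ) :
    lines R (L ++ L') q = overlay (lines R L) (lines R L') q := by
  rw [lines, List.map_append, superpose_append]; rfl

end Pattern

namespace Pattern

open Cyl (sg)

variable {B : Type*} {R : Set (List (B × Bool))}

/-! ### Patterns which connect two configurations -/

/-- There is a pattern of defects from the configuration `L` (below) to `L'` (above). -/
def Connects (R : Set (List (B × Bool))) (L L' : List (ℝ × (B × Bool))) : Prop :=
  ∃ (P : Pattern R) (T : ℝ), 1 ≤ T ∧ (∀ p, Good P p) ∧ (∀ q, q.2 < 1 → P q = lines R L q) ∧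
    (∀ q, T - 1 < q.2 → P q = lines R L' q) ∧ ∀ q, Real.pi ≤ |q.1| → P q = .region

lemma IsConfig.lines_outside {L : List (ℝ × (B × Bool))} (hL : IsConfig L) {q : ℝ × ℝ}
    (hq : Real.pi ≤ |q.1|) : lines R L q = .region := by
  refine lines_eq_region fun x hx h => ?_
  have := abs_lt.2 (hL.mem x hx)
  rw [h] at this
  linarith

-- The upper pattern is raised by `T - 1`, so that the end of one and the beginning of the other
-- overlap in the strip `T - 1 < t < T`. Both are the vertical lines `L'` there, and switching at `T
-- - 1 / 2` leaves no trace.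
open Classical in
lemma Connects.trans {L L' L'' : List (ℝ × (B × Bool))} (h : Connects R L L')
    (h' : Connects R L' L'') : Connects R L L'' := by
  obtain ⟨P, T, hT, hP, h0, h1, ho⟩ := h
  obtain ⟨P', T', hT', hP', h0', h1', ho'⟩ := h'
  have hlow : ∀ q : ℝ × ℝ, q.2 < T → P' (q - (0, T - 1)) = lines R L' q := fun q hq => by
    rw [h0' _ (by simp; linarith)]
    exact lines_congr _ (by simp)
  refine ⟨fun q => if q.2 < T - 1 / 2 then P q else P' (q - (0, T - 1)), T + T' - 1, by linarith,
    fun p => ?_, fun q hq => ?_, fun q hq => ?_, fun q hq => ?_⟩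
  · have hc : Continuous fun q : ℝ × ℝ => q.2 := continuous_snd
    by_cases hp : p.2 < T
    · refine (hP p).congr ?_
      filter_upwards [(isOpen_lt hc continuous_const).mem_nhds hp] with q hq
      split_ifs with h
      · rfl
      · rw [hlow q hq, h1 q (by linarith)]
    · refine ((hP' (p - (0, T - 1))).translate (0, T - 1)).congr ?_
      have hp' : T - 1 < p.2 := by linarith
      filter_upwards [(isOpen_lt continuous_const hc).mem_nhds hp'] with q hq
      split_ifs with h
      · rw [h1 q hq, hlow q (by linarith)]
      · rfl
  · change (if q.2 < T - 1 / 2 then P q else P' (q - (0, T - 1))) = _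
    split_ifs with h
    · exact h0 q hq
    · have : q.2 < T := by linarith
      rw [hlow q this, ← h1 q (by linarith), h0 q hq]
  · change (if q.2 < T - 1 / 2 then P q else P' (q - (0, T - 1))) = _
    have h2 : T' - 1 < (q - (0, T - 1)).2 := by simp; linarith
    split_ifs with h
    · have h3 : q.2 < T := by linarith
      rw [h1 q (by linarith), ← hlow q h3, h1' _ h2]
      exact lines_congr _ (by simp)
    · rw [h1' _ h2]
      exact lines_congr _ (by simp)
  · change (if q.2 < T - 1 / 2 then P q else P' (q - (0, T - 1))) = _
    split_ifs with h
    · exact ho q hq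
    · exact ho' _ (by simpa using hq)

/-- The activity in `[0, 1]` is raised to `[1, 2]` inside a strip of height `3`, which leaves
collars of width `1` at both ends. -/
lemma connects_of_unit {L L' : List (ℝ × (B × Bool))} {P : Pattern R} (hP : ∀ p, Good P p)
    (h0 : ∀ q, q.2 < 0 → P q = lines R L q) (h1 : ∀ q, 1 < q.2 → P q = lines R L' q)
    (ho : ∀ q, Real.pi ≤ |q.1| → P q = .region) : Connects R L L' := by
  refine ⟨fun q => P (q - (0, 1)), 3, by norm_num, fun p => (hP _).translate _, fun q hq => ?_,
    fun q hq => ?_, fun q hq => ho _ (by simpa using hq)⟩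
  · refine (h0 _ (by simpa using hq)).trans (lines_congr _ (by simp))
  · refine (h1 _ (by simp; linarith)).trans (lines_congr _ (by simp))

/-- A pattern may be inserted between vertical lines. -/
lemma connects_of_insert {L₁ L₂ A A' : List (ℝ × (B × Bool))} {α β : ℝ}
    (hL₁ : IsConfig L₁) (hL₂ : IsConfig L₂) (h₁ : ∀ x ∈ L₁, x.1 < α) (h₂ : ∀ x ∈ L₂, β < x.1)
    (hα : -Real.pi < α) (hβ : β < Real.pi) (hαβ : α ≤ β) {Q : Pattern R} (hQ : ∀ p, Good Q p)
    (hs : ∀ q, Q q ≠ .region → q.1 ∈ Icc α β) (h0 : ∀ q, q.2 < 0 → Q q = lines R A q)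
    (h1 : ∀ q, 1 < q.2 → Q q = lines R A' q) :
    Connects R (L₁ ++ A ++ L₂) (L₁ ++ A' ++ L₂) := by
  have r₁ : ∀ q : ℝ × ℝ, α ≤ q.1 → lines R L₁ q = .region := fun q hq =>
    lines_eq_region fun x hx h => by have := h₁ x hx; linarith
  have r₂ : ∀ q : ℝ × ℝ, q.1 ≤ β → lines R L₂ q = .region := fun q hq =>
    lines_eq_region fun x hx h => by have := h₂ x hx; linarith
  have rQ : ∀ q : ℝ × ℝ, (q.1 < α ∨ β < q.1) → Q q = .region := fun q hq => by
    by_contra h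
    have := hs q h
    rcases hq with hq | hq
    · exact absurd this.1 (not_le.2 hq)
    · exact absurd this.2 (not_le.2 hq)
  -- Where `Q` is itself a row of lines, superposing three patterns amounts to concatenating three
  -- rows.
  have key : ∀ A : List (ℝ × (B × Bool)), ∀ q, Q q = lines R A q →
      superpose [lines R L₁, Q, lines R L₂] q = lines R (L₁ ++ A ++ L₂) q := fun A q hq => by
    rw [List.append_assoc, lines_append]
    simp only [superpose, overlay, hq, lines_append]
    cases lines R L₁ q <;> cases lines R A q <;> cases lines R L₂ q <;> rfl
  refine connects_of_unit (P := superpose [lines R L₁, Q, lines R L₂]) (fun p => ?_)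
    (fun q hq => key A q (h0 q hq)) (fun q hq => key A' q (h1 q hq)) fun q hq => ?_
  · refine good_superpose ?_ ?_
    · simp only [List.mem_cons, List.not_mem_nil, or_false]
      rintro P (rfl | rfl | rfl)
      exacts [good_lines hL₁ p, hQ p, good_lines hL₂ p]
    · simp only [List.pairwise_cons, List.mem_cons, List.not_mem_nil, or_false]
      refine ⟨?_, ?_, by simp⟩
      · rintro P (rfl | rfl)
        · rcases lt_or_ge p.1 α with h | h
          · exact Or.inr (rQ p (Or.inl h))
          · exact Or.inl (r₁ p h)
        · rcases lt_or_ge p.1 α with h | h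
          · exact Or.inr (r₂ p (by linarith))
          · exact Or.inl (r₁ p h)
      · rintro P rfl
        rcases le_or_gt p.1 β with h | h
        · exact Or.inr (r₂ p h)
        · exact Or.inl (rQ p (Or.inr h))
  · refine superpose_eq_region.2 ?_
    simp only [List.mem_cons, List.not_mem_nil, or_false]
    rintro P (rfl | rfl | rfl)
    · exact hL₁.lines_outside hq
    · refine rQ q ?_
      rcases le_abs.1 hq with h | h
      · right; linarith
      · left; linarith
    · exact hL₂.lines_outside hq

/-! ### Moving the lines -/

lemma contDiff_smoothTransition : ContDiff ℝ ∞ Real.smoothTransition :=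
  Real.smoothTransition.contDiff

/-- Equality at the one height would not suffice: a wall also records its direction, which depends
on the derivative of `c`. -/
lemma graph_congr {c : ℝ → ℝ} {x : ℝ} {l : B × Bool} {q : ℝ × ℝ} (h : ∀ᶠ t in 𝓝 q.2, c t = x) :
    graph R c l q = graph R (fun _ => x) l q := by
  classical
  have h1 : HasDerivAt c 0 q.2 := (hasDerivAt_const q.2 x).congr_of_eventuallyEq h
  rw [graph_apply h1, graph_apply (hasDerivAt_const _ _), h.self_of_nhds]

/-- Each line moves from its old to its new position by convex combinations with a common smooth
parameter. These preserve strict order and the interval `(-π, π)`, so the lines never cross and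
never reach the cut. -/
lemma connects_of_pairs {K : List ((ℝ × ℝ) × (B × Bool))}
    (h : IsConfig (K.map fun k => (k.1.1, k.2))) (h' : IsConfig (K.map fun k => (k.1.2, k.2))) :
    Connects R (K.map fun k => (k.1.1, k.2)) (K.map fun k => (k.1.2, k.2)) := by
  set c : (ℝ × ℝ) × (B × Bool) → ℝ → ℝ := fun k t =>
    (1 - Real.smoothTransition t) * k.1.1 + Real.smoothTransition t * k.1.2 with hc
  have hcd : ∀ k, ContDiff ℝ ∞ (c k) := fun k =>
    ((contDiff_const.sub contDiff_smoothTransition).mul contDiff_const).add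
      (contDiff_smoothTransition.mul contDiff_const)
  have hs0 := Real.smoothTransition.nonneg
  have hs1 := Real.smoothTransition.le_one
  have hcl : ∀ k : (ℝ × ℝ) × (B × Bool), ∀ t a, k.1.1 < a → k.1.2 < a → c k t < a :=
    fun k t a h1 h2 => by
      rcases (hs0 t).eq_or_lt with h | h
      · simp only [hc, ← h]; linarith
      · nlinarith [hs1 t, hs0 t]
  have hcg : ∀ k : (ℝ × ℝ) × (B × Bool), ∀ t a, a < k.1.1 → a < k.1.2 → a < c k t :=
    fun k t a h1 h2 => by
      rcases (hs0 t).eq_or_lt with h | h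
      · simp only [hc, ← h]; linarith
      · nlinarith [hs1 t, hs0 t]
  refine connects_of_unit (P := superpose (K.map fun k => graph R (c k) k.2)) (fun p => ?_)
    (fun q hq => ?_) (fun q hq => ?_) (fun q hq => ?_)
  · refine good_superpose_graph K c hcd _ p ?_
    have h1 := List.pairwise_map.1 h.sorted
    have h2 := List.pairwise_map.1 h'.sorted
    refine (h1.and h2).imp fun {x y} hxy => ne_of_lt ?_
    have h3 := hs0 p.2
    have h4 := hs1 p.2
    have h5 : x.1.1 < y.1.1 := hxy.1
    have h6 : x.1.2 < y.1.2 := hxy.2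
    rcases h3.eq_or_lt with h | h
    · simp only [hc, ← h]; linarith
    · simp only [hc]; nlinarith
  · rw [lines, List.map_map]
    refine superpose_map_congr fun k _ => graph_congr ?_
    filter_upwards [gt_mem_nhds hq] with t ht
    simp [hc, Real.smoothTransition.zero_of_nonpos (le_of_lt ht)]
  · rw [lines, List.map_map]
    refine superpose_map_congr fun k _ => graph_congr ?_
    filter_upwards [lt_mem_nhds hq] with t ht
    simp [hc, Real.smoothTransition.one_of_one_le (le_of_lt ht)]
  · refine superpose_eq_region.2 fun P hP => ?_
    obtain ⟨k, hk, rfl⟩ := List.mem_map.1 hP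
    refine graph_eq_region fun h1 => ?_
    have h2 := h.mem _ (List.mem_map_of_mem hk)
    have h3 := h'.mem _ (List.mem_map_of_mem hk)
    have h4 := abs_lt.2 ⟨hcg k q.2 _ h2.1 h3.1, hcl k q.2 _ h2.2 h3.2⟩
    rw [← h1] at h4
    linarith

lemma connects_of_same_word {L L' : List (ℝ × (B × Bool))} (hL : IsConfig L) (hL' : IsConfig L')
    (h : L.map Prod.snd = L'.map Prod.snd) : Connects R L L' := by
  -- Equal words allow the entries of both configurations to be paired in order, with one common
  -- letter for each pair.
  obtain ⟨K, rfl, rfl⟩ : ∃ K : List ((ℝ × ℝ) × (B × Bool)),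
      K.map (fun k => (k.1.1, k.2)) = L ∧ K.map (fun k => (k.1.2, k.2)) = L' := by
    clear hL hL'
    induction L generalizing L' with
    | nil =>
      rw [List.map_nil, eq_comm, List.map_eq_nil_iff] at h
      exact ⟨[], rfl, h ▸ rfl⟩
    | cons x L ih =>
      cases L' with
      | nil => simp at h
      | cons y L' =>
        simp only [List.map_cons, List.cons.injEq] at h
        obtain ⟨K, h1, h2⟩ := ih h.2
        refine ⟨((x.1, y.1), x.2) :: K, ?_, ?_⟩
        · simp [h1]
        · simp [h2, h.1]
  exact connects_of_pairs hL hL'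

end Pattern

namespace Pattern

open Cyl (sg)

variable {B : Type*} {R : Set (List (B × Bool))}

/-! ### Cups, caps and vertices -/

/-- A smooth function which is the identity near `0` and on the negative axis, positive on the
positive axis, and `1` from `1` on. -/
noncomputable def ramp (t : ℝ) : ℝ :=
  t * (1 - Real.smoothTransition (2 * t - 1)) + Real.smoothTransition (2 * t - 1)

lemma contDiff_ramp : ContDiff ℝ ∞ ramp := by
  have h : ContDiff ℝ ∞ fun t : ℝ => Real.smoothTransition (2 * t - 1) :=
    contDiff_smoothTransition.comp ((contDiff_const.mul contDiff_id).sub contDiff_const)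
  exact (contDiff_id.mul (contDiff_const.sub h)).add h

lemma ramp_of_le {t : ℝ} (h : t ≤ 1 / 2) : ramp t = t := by
  rw [ramp, Real.smoothTransition.zero_of_nonpos (by linarith)]; ring

lemma ramp_of_ge {t : ℝ} (h : 1 ≤ t) : ramp t = 1 := by
  rw [ramp, Real.smoothTransition.one_of_one_le (by linarith)]; ring

lemma ramp_pos {t : ℝ} (h : 0 < t) : 0 < ramp t := by
  have h0 := Real.smoothTransition.nonneg (2 * t - 1)
  have h1 := Real.smoothTransition.le_one (2 * t - 1)
  rcases h0.eq_or_lt with h' | h'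
  · rw [ramp, ← h']; linarith
  · unfold ramp
    nlinarith [mul_nonneg h.le (sub_nonneg.2 h1)]

lemma ramp_neg {t : ℝ} (h : t < 0) : ramp t < 0 := by rwa [ramp_of_le (by linarith)]

lemma ramp_le_one (t : ℝ) : ramp t ≤ 1 := by
  rcases le_or_gt 1 t with h | h
  · rw [ramp_of_ge h]
  · have h1 := Real.smoothTransition.le_one (2 * t - 1)
    unfold ramp; nlinarith

lemma hasDerivAt_ramp (t : ℝ) : HasDerivAt ramp (deriv ramp t) t :=
  (contDiff_ramp.differentiable (by simp) t).hasDerivAt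

lemma deriv_ramp_of_lt {t : ℝ} (h : t < 1 / 2) : deriv ramp t = 1 := by
  have h1 : ramp =ᶠ[𝓝 t] id := by
    filter_upwards [gt_mem_nhds h] with s hs using ramp_of_le (le_of_lt hs)
  rw [h1.deriv_eq, deriv_id]

lemma deriv_ramp_of_gt {t : ℝ} (h : 1 < t) : deriv ramp t = 0 := by
  have h1 : ramp =ᶠ[𝓝 t] fun _ => 1 := by
    filter_upwards [lt_mem_nhds h] with s hs using ramp_of_ge (le_of_lt hs)
  rw [h1.deriv_eq, deriv_const]

/-- The equation of a cup (`τ = 1`) or a cap (`τ = -1`) with centre `x₀` and half-width `δ`. -/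
noncomputable def cupFun (x₀ δ κ τ s : ℝ) (q : ℝ × ℝ) : ℝ :=
  -- The zero set is a parabola near its apex and becomes two vertical legs where `ramp` is `1`. The
  -- factor `κ / (2 * δ)` makes the tangents of the legs `(0, ± κ)`, matching those of `lines`
  -- exactly.
  κ / (2 * δ) * (δ ^ 2 * ramp (τ * q.2 + s) - (q.1 - x₀) ^ 2)

lemma contDiff_cupFun (x₀ δ κ τ s : ℝ) : ContDiff ℝ ∞ (cupFun x₀ δ κ τ s) := by
  have h : ContDiff ℝ ∞ fun q : ℝ × ℝ => ramp (τ * q.2 + s) :=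
    contDiff_ramp.comp ((contDiff_const.mul contDiff_snd).add contDiff_const)
  exact contDiff_const.mul ((contDiff_const.mul h).sub ((contDiff_fst.sub contDiff_const).pow 2))

lemma hasFDerivAt_cupFun (x₀ δ κ τ s : ℝ) (q : ℝ × ℝ) :
    HasFDerivAt (cupFun x₀ δ κ τ s) ((κ / (2 * δ)) •
      ((δ ^ 2 * (deriv ramp (τ * q.2 + s) * τ)) • ContinuousLinearMap.snd ℝ ℝ ℝ -
        (2 * (q.1 - x₀)) • ContinuousLinearMap.fst ℝ ℝ ℝ)) q := by
  have h1 : HasDerivAt (fun t => δ ^ 2 * ramp (τ * t + s))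
      (δ ^ 2 * (deriv ramp (τ * q.2 + s) * τ)) q.2 := by
    have := (hasDerivAt_ramp (τ * q.2 + s)).comp q.2
      (((hasDerivAt_id q.2).const_mul τ).add_const s)
    simpa using this.const_mul (δ ^ 2)
  have h2 : HasDerivAt (fun x => (x - x₀) ^ 2) (2 * (q.1 - x₀)) q.1 := by
    simpa using! ((hasDerivAt_id q.1).sub_const x₀).pow 2
  exact ((h1.comp_hasFDerivAt q hasFDerivAt_snd).sub
    (h2.comp_hasFDerivAt q hasFDerivAt_fst)).const_mul _

lemma cupFun_eq_zero {x₀ δ κ τ s : ℝ} (hδ : 0 < δ) (hκ : κ ≠ 0) {q : ℝ × ℝ} :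
    cupFun x₀ δ κ τ s q = 0 ↔ (q.1 - x₀) ^ 2 = δ ^ 2 * ramp (τ * q.2 + s) := by
  have : κ / (2 * δ) ≠ 0 := div_ne_zero hκ (by positivity)
  rw [cupFun, mul_eq_zero, or_iff_right this, sub_eq_zero, eq_comm]

/-- At a singular zero the `x`-derivative forces `x = x₀`, so `ramp` vanishes and its argument is
`0`. But there `ramp` has slope `1`, and the `t`-derivative is nonzero. -/
lemma good_cup {x₀ δ κ τ s : ℝ} (hδ : 0 < δ) (hκ : κ ≠ 0) (hτ : τ ≠ 0) (b : B) (p : ℝ × ℝ) :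
    Good (curve R (cupFun x₀ δ κ τ s) b) p := by
  refine good_curve (contDiff_cupFun _ _ _ _ _) b fun h0 h => ?_
  rw [cupFun_eq_zero hδ hκ] at h0
  rw [(hasFDerivAt_cupFun _ _ _ _ _ _).fderiv] at h
  have h1 := congrArg (fun L : ℝ × ℝ →L[ℝ] ℝ => L (1, 0)) h
  have h2 := congrArg (fun L : ℝ × ℝ →L[ℝ] ℝ => L (0, 1)) h
  simp [hκ, hδ.ne', hτ] at h1 h2
  rw [h1] at h0
  have h3 : ramp (τ * p.2 + s) = 0 := by
    have h4 : δ ^ 2 ≠ 0 := by positivity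
    have h5 : δ ^ 2 * ramp (τ * p.2 + s) = 0 := by rw [← h0]; ring
    exact (mul_eq_zero.1 h5).resolve_left h4
  have h4 : τ * p.2 + s = 0 := by
    rcases lt_trichotomy (τ * p.2 + s) 0 with h | h | h
    · exact absurd h3 (ramp_neg h).ne
    · exact h
    · exact absurd h3 (ramp_pos h).ne'
  rw [h4, deriv_ramp_of_lt (by norm_num)] at h2
  norm_num at h2

lemma cup_empty {x₀ δ κ τ s : ℝ} (hδ : 0 < δ) (hκ : κ ≠ 0) (b : B) {q : ℝ × ℝ}
    (hq : τ * q.2 + s < 0) : curve R (cupFun x₀ δ κ τ s) b q = .region := by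
  refine if_neg fun h => ?_
  rw [cupFun_eq_zero hδ hκ] at h
  have := mul_neg_of_pos_of_neg (pow_pos hδ 2) (ramp_neg hq)
  nlinarith [sq_nonneg (q.1 - x₀)]

/-- The tangent is proportional to `q.1 - x₀`, so one leg goes up and the other down. A single
oriented wall `b` thus reads as a letter on one leg and as its inverse on the other. -/
lemma cup_full {x₀ δ τ s : ℝ} (hδ : 0 < δ) (b : B) (ε : Bool) {q : ℝ × ℝ}
    (hq : 1 < τ * q.2 + s) : curve R (cupFun x₀ δ (-sg ε) τ s) b q =
      lines R [(x₀ - δ, (b, ε)), (x₀ + δ, (b, !ε))] q := by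
  have hκ : -sg ε ≠ 0 := neg_ne_zero.2 (sg_ne_zero ε)
  have h0 : cupFun x₀ δ (-sg ε) τ s q = 0 ↔ q.1 = x₀ - δ ∨ q.1 = x₀ + δ := by
    rw [cupFun_eq_zero hδ hκ, ramp_of_ge hq.le, mul_one, sq_eq_sq_iff_eq_or_eq_neg]
    constructor
    · rintro (h | h)
      · right; linarith
      · left; linarith
    · rintro (h | h)
      · right; linarith
      · left; linarith
  have ht : tangent (cupFun x₀ δ (-sg ε) τ s) q = (0, -sg ε * (q.1 - x₀) / δ) := by
    simp only [tangent, (hasFDerivAt_cupFun _ _ _ _ _ _).fderiv, deriv_ramp_of_gt hq]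
    ext
    · simp
    · simp; field_simp
  simp only [lines, List.map_cons, List.map_nil, superpose, overlay, line_apply]
  by_cases h1 : q.1 = x₀ - δ
  · rw [curve, if_pos (h0.2 (Or.inl h1)), ht, if_pos h1, h1]
    congr 2
    field_simp; ring
  · by_cases h2 : q.1 = x₀ + δ
    · rw [curve, if_pos (h0.2 (Or.inr h2)), ht, if_neg h1, if_pos h2, h2]
      congr 2
      have : sg (!ε) = -sg ε := by cases ε <;> simp [sg]
      rw [this]
      field_simp; ring
    · rw [curve, if_neg (fun h => (h0.1 h).elim h1 h2), if_neg h1, if_neg h2]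

lemma cup_support {x₀ δ κ τ s : ℝ} (hδ : 0 < δ) (hκ : κ ≠ 0) (b : B) {q : ℝ × ℝ}
    (hq : curve R (cupFun x₀ δ κ τ s) b q ≠ .region) : q.1 ∈ Icc (x₀ - δ) (x₀ + δ) := by
  have h0 : cupFun x₀ δ κ τ s q = 0 := by
    by_contra h; exact hq (if_neg h)
  rw [cupFun_eq_zero hδ hκ] at h0
  have h1 : (q.1 - x₀) ^ 2 ≤ δ ^ 2 := by
    rw [h0]; exact mul_le_of_le_one_right (sq_nonneg δ) (ramp_le_one _)
  have h2 := abs_le.1 (abs_le_of_sq_le_sq h1 hδ.le)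
  constructor <;> linarith [h2.1, h2.2]

lemma IsConfig.sublist {L L' : List (ℝ × (B × Bool))} (hL : IsConfig L) (h : L'.Sublist L) :
    IsConfig L' :=
  ⟨hL.sorted.sublist h, fun x hx => hL.mem x (h.subset hx)⟩

/-- Two adjacent inverse letters may be created and annihilated. -/
lemma connects_cup {L₁ L₂ : List (ℝ × (B × Bool))} {x y : ℝ} {b : B} {ε : Bool}
    (h : IsConfig (L₁ ++ [(x, (b, ε)), (y, (b, !ε))] ++ L₂)) :
    Connects R (L₁ ++ [] ++ L₂) (L₁ ++ [(x, (b, ε)), (y, (b, !ε))] ++ L₂) ∧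
    Connects R (L₁ ++ [(x, (b, ε)), (y, (b, !ε))] ++ L₂) (L₁ ++ [] ++ L₂) := by
  have hL₁ : IsConfig L₁ := h.sublist (by simp)
  have hL₂ : IsConfig L₂ := h.sublist (List.sublist_append_right _ _)
  have hs := h.sorted
  simp only [List.append_assoc, List.pairwise_append, List.pairwise_cons, List.mem_cons,
    List.cons_append, List.nil_append] at hs
  have hxy : x < y := hs.2.1.1 _ (Or.inl rfl)
  have h₁ : ∀ z ∈ L₁, z.1 < x := fun z hz => hs.2.2 z hz _ (Or.inl rfl)
  have h₂ : ∀ z ∈ L₂, y < z.1 := fun z hz => hs.2.1.2.1 z hz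
  have hx : -Real.pi < x := (h.mem (x, (b, ε)) (by simp)).1
  have hy : y < Real.pi := (h.mem (y, (b, !ε)) (by simp)).2
  have hδ : 0 < (y - x) / 2 := by linarith
  have hκ : -sg ε ≠ 0 := neg_ne_zero.2 (sg_ne_zero ε)
  have e1 : (x + y) / 2 - (y - x) / 2 = x := by ring
  have e2 : (x + y) / 2 + (y - x) / 2 = y := by ring
  have hsupp : ∀ τ s (q : ℝ × ℝ),
      curve R (cupFun ((x + y) / 2) ((y - x) / 2) (-sg ε) τ s) b q ≠ .region → q.1 ∈ Icc x y :=
    fun τ s q hq => by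
      have := cup_support hδ hκ b hq
      rwa [e1, e2] at this
  have hfull : ∀ τ s (q : ℝ × ℝ), 1 < τ * q.2 + s →
      curve R (cupFun ((x + y) / 2) ((y - x) / 2) (-sg ε) τ s) b q =
        lines R [(x, (b, ε)), (y, (b, !ε))] q := fun τ s q hq => by
      have := cup_full (R := R) (x₀ := (x + y) / 2) hδ b ε hq
      rwa [e1, e2] at this
  constructor
  · refine connects_of_insert hL₁ hL₂ h₁ h₂ hx hy hxy.le
      (good_cup (x₀ := (x + y) / 2) (s := 0) hδ hκ one_ne_zero b) (hsupp 1 0) (fun q hq => ?_)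
      (fun q hq => ?_)
    · exact cup_empty hδ hκ b (by linarith)
    · exact hfull 1 0 q (by linarith)
  -- With `τ = -1` and `s = 1` the argument of `ramp` is `1 - t`: the two legs are vertical for `t <
  -- 0` and the curve is empty for `t > 1`.
  · refine connects_of_insert hL₁ hL₂ h₁ h₂ hx hy hxy.le
      (good_cup (x₀ := (x + y) / 2) (τ := -1) (s := 1) hδ hκ (by norm_num) b) (hsupp (-1) 1)
      (fun q hq => ?_) (fun q hq => ?_)
    · exact hfull (-1) 1 q (by linarith)
    · exact cup_empty hδ hκ b (by linarith)

/-! ### Vertices with all branches going up. -/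

open Classical in
/-- A vertex at `(x₀, 0)`, from which lines go up to the positions and labels `A`. -/
noncomputable def star (u : R × Bool) (x₀ : ℝ) (A : List (ℝ × (B × Bool))) : Pattern R := fun q =>
  if q = (x₀, 0) then .vertex u
  else if 0 < q.2 then
    superpose (A.map fun x => graph R (fun t => x₀ + (x.1 - x₀) * ramp t) x.2) q
  else .region

lemma contDiff_ray (x₀ a : ℝ) : ContDiff ℝ ∞ fun t => x₀ + a * ramp t :=
  contDiff_const.add (contDiff_const.mul contDiff_ramp)

lemma hasDerivAt_ray (x₀ a t : ℝ) :
    HasDerivAt (fun t => x₀ + a * ramp t) (a * deriv ramp t) t :=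
  ((hasDerivAt_ramp t).const_mul a).const_add x₀

/-- The cyclic word read by a small circle around the vertex of a star. -/
def incoming (A : List (ℝ × (B × Bool))) : List (B × Bool) :=
  A.reverse.map fun x => (x.2.1, !x.2.2)

lemma incoming_eq (A : List (ℝ × (B × Bool))) :
    incoming A = FreeGroup.invRev (A.map Prod.snd) := by
  simp [incoming, FreeGroup.invRev, Function.comp_def]

/-- Since `ramp` is the identity up to `1 / 2`, the branches start as straight rays. They stay apart
above the vertex because `ramp` is positive there. Counterclockwise order goes from right to left,
hence the reversal of `A`. -/
lemma good_star {u : R × Bool} {x₀ : ℝ} {A : List (ℝ × (B × Bool))}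
    (hA : A.Pairwise fun x y => x.1 < y.1)
    (hu : (presentationDefectData R).ψ₀₁ u = (incoming A : Cycle (B × Bool))) (p : ℝ × ℝ) :
    Good (star u x₀ A) p := by
  have hc : Continuous fun q : ℝ × ℝ => q.2 := continuous_snd
  have hA' : A.Pairwise fun x y : ℝ × (B × Bool) => x.1 - x₀ < y.1 - x₀ :=
    hA.imp fun h => by linarith
  rcases lt_trichotomy p.2 0 with hp | hp | hp
  · refine .region ?_
    filter_upwards [(isOpen_lt hc continuous_const).mem_nhds hp] with q hq
    have h1 : q.2 < 0 := hq
    have h2 : q ≠ (x₀, 0) := fun h => by simp [h] at h1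
    rw [star, if_neg h2, if_neg h1.not_gt]
  · by_cases hp0 : p = (x₀, 0)
    · subst hp0
      have hlen : (incoming A).length = A.reverse.length := List.length_map _
      refine .vertex u (incoming A) (fun k => (A.reverse.get (k.cast hlen)).1 - x₀) hu ?_
        (if_pos rfl) ?_
      · intro i j hij
        have h1 := List.pairwise_iff_get.1 (List.pairwise_reverse.2 hA') (i.cast hlen) (j.cast hlen)
          hij
        exact h1
      · have h12 : ((x₀, 0) : ℝ × ℝ).2 < 1 / 2 := by norm_num
        filter_upwards [(isOpen_lt hc continuous_const).mem_nhds h12] with q hq hqp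
        have hq : q.2 < 1 / 2 := hq
        by_cases h0 : 0 < q.2
        · have hval : ∀ x : ℝ × (B × Bool), graph R (fun t => x₀ + (x.1 - x₀) * ramp t) x.2 q =
              open Classical in if q.1 = x₀ + (x.1 - x₀) * q.2 then
                .wall x.2.1 (sg x.2.2 * (x.1 - x₀), sg x.2.2) else .region := fun x => by
            rw [graph_apply (hasDerivAt_ray _ _ _), deriv_ramp_of_lt hq, mul_one,
              ramp_of_le hq.le]
          have hstar : star u x₀ A q =
              superpose (A.map fun x => graph R (fun t => x₀ + (x.1 - x₀) * ramp t) x.2) q := by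
            rw [star, if_neg hqp, if_pos h0]
          rw [hstar]
          by_cases hr : superpose
              (A.map fun x => graph R (fun t => x₀ + (x.1 - x₀) * ramp t) x.2) q = .region
          · refine Or.inl ⟨hr, fun k hk => ?_⟩
            rw [superpose_eq_region] at hr
            have h2 := hr _ (List.mem_map_of_mem (List.mem_reverse.1
              (List.get_mem A.reverse (k.cast hlen))))
            rw [hval, if_pos] at h2
            · simp at h2
            · have := hk.2
              simp only [sub_zero] at this
              linarith
          · right
            obtain ⟨P, hP, h2, h3⟩ := superpose_eq_of_ne hr
            obtain ⟨x, hx, rfl⟩ := List.mem_map.1 hP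
            obtain ⟨k, hk⟩ := List.mem_iff_get.1 (List.mem_reverse.2 hx)
            have h4 : q.1 = x₀ + (x.1 - x₀) * q.2 := by
              by_contra h
              rw [hval, if_neg h] at h2
              exact h2 rfl
            refine ⟨k.cast hlen.symm, ⟨h0, ?_⟩, ?_⟩
            · simp only [Fin.cast_cast, Fin.cast_eq_self, hk, sub_zero, h4]
              ring
            · rw [h3, hval, if_pos h4]
              have h5 : (incoming A).get (k.cast hlen.symm) = (x.2.1, !x.2.2) := by
                rw [← hk]; simp only [incoming, List.get_eq_getElem, List.getElem_map]; rfl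
              have h6 : sg (!x.2.2) = -sg x.2.2 := by cases x.2.2 <;> simp [sg]
              simp only [h5, Fin.cast_cast, Fin.cast_eq_self, hk, h6, neg_neg]
        · refine Or.inl ⟨?_, fun k hk => h0 hk.1⟩
          rw [star, if_neg hqp, if_neg h0]
    · refine .region ?_
      have hx : p.1 ≠ x₀ := fun h => hp0 (Prod.ext h hp)
      -- At height `0` every branch passes through `x₀`, so a point of that height with another
      -- abscissa has a neighbourhood which misses all of them.
      have h1 : ∀ᶠ q : ℝ × ℝ in 𝓝 p, ∀ x ∈ A, q.1 ≠ x₀ + (x.1 - x₀) * ramp q.2 := by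
        refine (Filter.eventually_all_finite (List.finite_toSet A)).2 fun x _ => ?_
        have h2 : Continuous fun q : ℝ × ℝ => q.1 - (x₀ + (x.1 - x₀) * ramp q.2) :=
          continuous_fst.sub ((contDiff_ray x₀ (x.1 - x₀)).continuous.comp continuous_snd)
        have h3 : p.1 - (x₀ + (x.1 - x₀) * ramp p.2) ≠ 0 := by
          rw [hp, ramp_of_le (by norm_num), mul_zero, add_zero]
          exact sub_ne_zero.2 hx
        filter_upwards [h2.continuousAt.eventually_ne h3] with q hq using sub_ne_zero.1 hq
      filter_upwards [h1, continuous_id.continuousAt.eventually_ne hp0] with q hq hq'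
      rw [star, if_neg (show q ≠ (x₀, 0) from hq')]
      split_ifs
      · refine superpose_eq_region.2 fun P hP => ?_
        obtain ⟨x, hx, rfl⟩ := List.mem_map.1 hP
        exact graph_eq_region (hq x hx)
      · rfl
  · refine (good_superpose_graph A (fun x t => x₀ + (x.1 - x₀) * ramp t)
      (fun x => contDiff_ray _ _) Prod.snd p (hA.imp fun {x y} h => ?_)).congr ?_
    · have := ramp_pos hp
      intro h'
      have h2 := mul_right_cancel₀ this.ne' (add_left_cancel h')
      linarith
    · filter_upwards [(isOpen_lt continuous_const hc).mem_nhds hp] with q hq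
      have h1 : 0 < q.2 := hq
      have h2 : q ≠ (x₀, 0) := fun h => by simp [h] at h1
      rw [star, if_neg h2, if_pos h1]

/-- A relator may be inserted. -/
lemma connects_star {L₁ A L₂ : List (ℝ × (B × Bool))} (h : IsConfig (L₁ ++ A ++ L₂))
    (hA : A ≠ []) {u : R × Bool}
    (hu : (presentationDefectData R).ψ₀₁ u =
      (FreeGroup.invRev (A.map Prod.snd) : Cycle (B × Bool))) :
    Connects R (L₁ ++ [] ++ L₂) (L₁ ++ A ++ L₂) := by
  rw [← incoming_eq] at hu
  have hL₁ : IsConfig L₁ := h.sublist (by simp)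
  have hL₂ : IsConfig L₂ := h.sublist (by simp)
  have hs := h.sorted
  simp only [List.append_assoc, List.pairwise_append, List.mem_append] at hs
  have hmem : ∀ x ∈ A, x.1 ∈ Ioo (-Real.pi) Real.pi := fun x hx => h.mem x (by simp [hx])
  obtain ⟨x, A', rfl⟩ := List.exists_cons_of_ne_nil hA
  obtain ⟨y, hy, hyle⟩ : ∃ y ∈ x :: A', ∀ z ∈ x :: A', z.1 ≤ y.1 := by
    obtain ⟨y, hy⟩ := (List.finite_toSet (x :: A')).exists_maximalFor Prod.fst _ ⟨x, by simp⟩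
    exact ⟨y, hy.1, fun z hz => (le_total z.1 y.1).elim id (hy.2 hz)⟩
  have hxle : ∀ z ∈ x :: A', x.1 ≤ z.1 := by
    intro z hz
    rcases List.mem_cons.1 hz with rfl | hz
    · exact le_rfl
    · exact ((List.pairwise_cons.1 hs.2.1.1).1 z hz).le
  -- The vertex lies below the leftmost line, so each branch moves by convex combinations of `x.1`
  -- and its final position and stays between the leftmost and rightmost lines.
  refine connects_of_insert hL₁ hL₂ (fun z hz => hs.2.2 z hz x (Or.inl List.mem_cons_self))
    (fun z hz => hs.2.1.2.2 y hy z hz) (hmem x List.mem_cons_self).1 (hmem y hy).2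
    (hxle y hy) (good_star (x₀ := x.1) hs.2.1.1 hu) (fun q hq => ?_) (fun q hq => ?_)
    (fun q hq => ?_)
  · by_cases h0 : q = (x.1, 0)
    · rw [h0]; exact ⟨le_rfl, hxle y hy⟩
    · rw [star, if_neg h0] at hq
      split_ifs at hq with h1
      · obtain ⟨P, hP, h2, -⟩ := superpose_eq_of_ne hq
        obtain ⟨z, hz, rfl⟩ := List.mem_map.1 hP
        have h3 : q.1 = x.1 + (z.1 - x.1) * ramp q.2 := by
          by_contra h4; exact h2 (graph_eq_region h4)
        have h4 := hxle z hz
        have h5 := hyle z hz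
        have h6 := (ramp_pos h1).le
        have h7 := ramp_le_one q.2
        rw [h3]
        constructor <;> nlinarith
      · exact absurd rfl hq
  · have h2 : q ≠ (x.1, 0) := fun h => by simp [h] at hq
    rw [star, if_neg h2, if_neg hq.not_gt]
    rfl
  · have h1 : 0 < q.2 := by linarith
    have h2 : q ≠ (x.1, 0) := fun h => by simp [h] at h1
    rw [star, if_neg h2, if_pos h1, lines]
    refine superpose_map_congr fun z _ => graph_congr ?_
    filter_upwards [lt_mem_nhds hq] with t ht
    rw [ramp_of_ge (le_of_lt ht)]; ring

end Pattern

namespace Pattern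

variable {B : Type*} {R : Set (List (B × Bool))}

/-! ### Words -/

/-- Placing each letter halfway between the previous bound and `π` always leaves room for the rest.
-/
lemma exists_config_above (w : List (B × Bool)) {a : ℝ} (ha : -Real.pi ≤ a) (ha' : a < Real.pi) :
    ∃ L : List (ℝ × (B × Bool)), IsConfig L ∧ L.map Prod.snd = w ∧ ∀ x ∈ L, a < x.1 := by
  induction w generalizing a with
  | nil => exact ⟨[], ⟨List.Pairwise.nil, by simp⟩, rfl, by simp⟩
  | cons l w ih =>
    obtain ⟨L, hL, hw, hm⟩ := ih (a := (a + Real.pi) / 2) (by linarith) (by linarith)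
    refine ⟨((a + Real.pi) / 2, l) :: L, ⟨List.pairwise_cons.2 ⟨hm, hL.sorted⟩, ?_⟩, by simp [hw], ?_⟩
    · intro x hx
      rcases List.mem_cons.1 hx with rfl | hx
      · constructor <;> simp only <;> linarith
      · exact hL.mem x hx
    · intro x hx
      rcases List.mem_cons.1 hx with rfl | hx
      · simp only; linarith
      · have := hm x hx; linarith

lemma exists_config (w : List (B × Bool)) :
    ∃ L : List (ℝ × (B × Bool)), IsConfig L ∧ L.map Prod.snd = w := by
  obtain ⟨L, h, h', -⟩ := exists_config_above w le_rfl (by linarith [Real.pi_pos])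
  exact ⟨L, h, h'⟩

/-- Some configurations which read `w` and `w'` are connected by a pattern. -/
def WordConnects (R : Set (List (B × Bool))) (w w' : List (B × Bool)) : Prop :=
  ∃ L L', IsConfig L ∧ IsConfig L' ∧ L.map Prod.snd = w ∧ L'.map Prod.snd = w' ∧ Connects R L L'

/-- Configurations with the same word can be slid into each other, so a picture for one choice of
positions serves for all choices. -/
lemma WordConnects.connects {L L' : List (ℝ × (B × Bool))} (hL : IsConfig L) (hL' : IsConfig L')
    (h : WordConnects R (L.map Prod.snd) (L'.map Prod.snd)) : Connects R L L' := by
  obtain ⟨K, K', hK, hK', hw, hw', hc⟩ := h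
  exact ((connects_of_same_word hL hK hw.symm).trans hc).trans
    (connects_of_same_word hK' hL' hw')

lemma WordConnects.refl (w : List (B × Bool)) : WordConnects R w w := by
  obtain ⟨L, hL, rfl⟩ := exists_config w
  exact ⟨L, L, hL, hL, rfl, rfl, connects_of_same_word hL hL rfl⟩

lemma WordConnects.trans {w w' w'' : List (B × Bool)} (h : WordConnects R w w')
    (h' : WordConnects R w' w'') : WordConnects R w w'' := by
  obtain ⟨L, L', hL, hL', rfl, rfl, hc⟩ := h
  obtain ⟨K, K', hK, hK', hw, rfl, hc'⟩ := h'
  exact ⟨L, K', hL, hK', rfl, rfl, (hc.trans (connects_of_same_word hL' hK hw.symm)).trans hc'⟩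

lemma exists_split {u v w : List (B × Bool)} : ∃ L₁ A L₂ : List (ℝ × (B × Bool)),
    IsConfig (L₁ ++ A ++ L₂) ∧ L₁.map Prod.snd = u ∧ A.map Prod.snd = v ∧ L₂.map Prod.snd = w := by
  obtain ⟨L, hL, hw⟩ := exists_config (u ++ v ++ w)
  obtain ⟨L', L₂, rfl, hw', h2⟩ := List.map_eq_append_iff.1 hw
  obtain ⟨L₁, A, rfl, h1, h3⟩ := List.map_eq_append_iff.1 hw'
  exact ⟨L₁, A, L₂, hL, h1, h3, h2⟩

lemma wordConnects_step {w w' : List (B × Bool)} (h : FreeGroup.Red.Step w w') :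
    WordConnects R w w' ∧ WordConnects R w' w := by
  obtain ⟨⟩ := h
  rename_i u v b ε
  obtain ⟨L₁, A, L₂, hL, rfl, hA, rfl⟩ := exists_split (u := u) (v := [(b, ε), (b, !ε)]) (w := v)
  obtain ⟨⟨x, l⟩, A', rfl, rfl, hA'⟩ := List.map_eq_cons_iff.1 hA
  obtain ⟨⟨y, l'⟩, A'', rfl, rfl, hA''⟩ := List.map_eq_cons_iff.1 hA'
  obtain rfl := List.map_eq_nil_iff.1 hA''
  have hc := connects_cup (R := R) hL
  have h0 : IsConfig (L₁ ++ [] ++ L₂) := hL.sublist (by simp)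
  exact ⟨⟨_, _, hL, h0, by simp, by simp, hc.2⟩, ⟨_, _, h0, hL, by simp, by simp, hc.1⟩⟩

lemma wordConnects_red {w w' : List (B × Bool)} (h : FreeGroup.Red w w') :
    WordConnects R w w' ∧ WordConnects R w' w := by
  induction h with
  | refl => exact ⟨.refl _, .refl _⟩
  | tail _ h ih =>
    have := wordConnects_step (R := R) h
    exact ⟨ih.1.trans this.1, this.2.trans ih.2⟩

/-- Church–Rosser: equal elements of the free group have a common reduct, reached by caps from `w`
and left by cups towards `w'`. -/
lemma wordConnects_of_mk_eq {w w' : List (B × Bool)} (h : FreeGroup.mk w = FreeGroup.mk w') :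
    WordConnects R w w' := by
  obtain ⟨c, h1, h2⟩ := FreeGroup.Red.exact.1 h
  exact (wordConnects_red h1).1.trans (wordConnects_red h2).2

lemma wordConnects_insert (u v : List (B × Bool)) {r : List (B × Bool)} (hr : r ∈ R) (ε : Bool) :
    WordConnects R (u ++ v) (u ++ (if ε then r else FreeGroup.invRev r) ++ v) := by
  obtain ⟨L₁, A, L₂, hL, rfl, hA, rfl⟩ :=
    exists_split (u := u) (v := if ε then r else FreeGroup.invRev r) (w := v)
  -- An empty relator changes nothing; it is treated apart because a star needs at least one branch.
  rcases eq_or_ne A [] with rfl | hne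
  · rw [← hA]
    simpa using! WordConnects.refl (R := R) _
  have h0 : IsConfig (L₁ ++ [] ++ L₂) := hL.sublist (by simp)
  -- Around the vertex the letters are read towards it, which gives the inverse of the word read
  -- upwards; hence the opposite sign `!ε`.
  refine ⟨_, _, h0, hL, by simp, by simp [hA], connects_star hL hne (u := (⟨r, hr⟩, !ε)) ?_⟩
  rw [hA]
  cases ε <;> simp

/-- Words which represent the same element of the presented group are connected. -/
lemma wordConnects_of_presentedGroup_eq {w w' : List (B × Bool)}
    (h : PresentedGroup.mk (FreeGroup.mk '' R) (FreeGroup.mk w) =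
      PresentedGroup.mk (FreeGroup.mk '' R) (FreeGroup.mk w')) : WordConnects R w w' := by
  have h1 : (FreeGroup.mk w)⁻¹ * FreeGroup.mk w' ∈
      Subgroup.normalClosure (FreeGroup.mk '' R : Set (FreeGroup B)) := QuotientGroup.eq.1 h
  -- Quantifying over all pairs of words lets a product `g * g'` pass through an intermediate word
  -- for `w * g`.
  have key : ∀ g ∈ Subgroup.normalClosure (FreeGroup.mk '' R : Set (FreeGroup B)),
      ∀ w w', FreeGroup.mk w' = FreeGroup.mk w * g → WordConnects R w w' := by
    have conj : ∀ r ∈ R, ∀ (c : FreeGroup B) (ε : Bool), ∀ w w',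
        FreeGroup.mk w' = FreeGroup.mk w *
          (c * FreeGroup.mk (if ε then r else FreeGroup.invRev r) * c⁻¹) →
        WordConnects R w w' := by
      intro r hr c ε w w' h
      induction c using Quot.inductionOn with | _ l
      -- A conjugate is inserted by first passing from `w` to `w l l⁻¹` and then placing the relator
      -- between `l` and `l⁻¹`.
      have e1 : WordConnects R w ((w ++ l) ++ FreeGroup.invRev l) := by
        refine wordConnects_of_mk_eq ?_
        rw [← FreeGroup.mul_mk, ← FreeGroup.mul_mk, ← FreeGroup.inv_mk, mul_inv_cancel_right]
      refine (e1.trans (wordConnects_insert _ _ hr ε)).trans (wordConnects_of_mk_eq ?_)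
      rw [h]
      change _ = FreeGroup.mk w * (FreeGroup.mk l * _ * (FreeGroup.mk l)⁻¹)
      rw [← FreeGroup.mul_mk, ← FreeGroup.mul_mk, ← FreeGroup.mul_mk, ← FreeGroup.inv_mk]
      group
    intro g hg
    induction hg using Subgroup.closure_induction'' with
    | mem g hg =>
      obtain ⟨_, ⟨r, hr, rfl⟩, hc⟩ := Group.mem_conjugatesOfSet_iff.1 hg
      obtain ⟨c, rfl⟩ := isConj_iff.1 hc
      exact conj r hr c true
    | inv_mem g hg =>
      obtain ⟨_, ⟨r, hr, rfl⟩, hc⟩ := Group.mem_conjugatesOfSet_iff.1 hg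
      obtain ⟨c, rfl⟩ := isConj_iff.1 hc
      intro w w' h
      refine conj r hr c false w w' (h.trans ?_)
      rw [if_neg (by simp), ← FreeGroup.inv_mk]
      group
    | one => exact fun w w' h => wordConnects_of_mk_eq (by rw [h, mul_one])
    | mul g g' _ _ ih ih' =>
      intro w w' h
      obtain ⟨m, hm⟩ : ∃ m, FreeGroup.mk m = FreeGroup.mk w * g :=
        Quot.exists_rep (FreeGroup.mk w * g)
      exact (ih w m hm).trans (ih' m w' (by rw [h, hm, mul_assoc]))
  exact key _ h1 w w' (by rw [mul_inv_cancel_left])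

end Pattern

/-! ## The surface with defects of a pattern -/

namespace Mark

variable {B : Type*} {R : Set (List (B × Bool))}

/-- The label of a stratum. -/
def label : Mark R → StratumLabel (presentationDefectData R)
  | region => .region PUnit.unit
  -- Walls always carry a positive letter; the sign of the letter which is read is encoded in the
  -- direction.
  | wall b _ => .wall (b, true)
  | vertex u => .vertex u

/-- The direction of a wall. -/
def dir : Mark R → ℝ × ℝ
  | region => 0
  | wall _ v => v
  | vertex _ => 0

lemma dim_label_eq_two {m : Mark R} : m.label.dim = 2 ↔ m = region := by
  cases m <;> simp [label, StratumLabel.dim]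

lemma dim_label_eq_one {m : Mark R} : m.label.dim = 1 ↔ ∃ b v, m = wall b v := by
  cases m <;> simp [label, StratumLabel.dim]

lemma dim_label_eq_zero {m : Mark R} : m.label.dim = 0 ↔ ∃ u, m = vertex u := by
  cases m <;> simp [label, StratumLabel.dim]

end Mark

namespace Pattern

open Cyl

variable {B : Type*} {R : Set (List (B × Bool))}

/-- `P` is a pattern of defects in the strip of height `T`, from `L` to `L'`. -/
structure IsBetween (P : Pattern R) (T : ℝ) (L L' : List (ℝ × (B × Bool))) : Prop where
  good : ∀ p, Good P p
  low : ∀ q, q.2 < 1 → P q = lines R L q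
  high : ∀ q, T - 1 < q.2 → P q = lines R L' q
  outside : ∀ q, Real.pi ≤ |q.1| → P q = .region
  config_low : IsConfig L
  config_high : IsConfig L'

variable {P : Pattern R} {T : ℝ} {L L' : List (ℝ × (B × Bool))}

/-- The pattern, seen on the cylinder. -/
noncomputable def mark (P : Pattern R) (q : Cyl T) : Mark R := P (Complex.arg q.1, q.2)

lemma lines_ne_vertex (q : ℝ × ℝ) (u : R × Bool) : lines R L q ≠ .vertex u := by
  intro h
  obtain ⟨Q, hQ, h1, h2⟩ := superpose_eq_of_ne (show lines R L q ≠ .region by rw [h]; simp)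
  obtain ⟨x, -, rfl⟩ := List.mem_map.1 hQ
  rw [lines] at h
  rw [h, line_apply] at h2
  split_ifs at h2

lemma contDiff_pair {F₁ F₂ : ℝ × ℝ → ℝ} (h₁ : ContDiff ℝ ∞ F₁) (h₂ : ContDiff ℝ ∞ F₂) :
    ContDiff ℝ ∞ fun z => (!₂[F₁ z, F₂ z] : Plane) := by
  have h : ContDiff ℝ ∞ fun z => rot (-F₂ z, F₁ z) := rot.contDiff.comp (h₂.neg.prodMk h₁)
  simpa using h

lemma fderiv_pair {F₁ F₂ : ℝ × ℝ → ℝ} {z : ℝ × ℝ} (h₁ : DifferentiableAt ℝ F₁ z)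
    (h₂ : DifferentiableAt ℝ F₂ z) (v : ℝ × ℝ) :
    fderiv ℝ (fun z => (!₂[F₁ z, F₂ z] : Plane)) z v = !₂[fderiv ℝ F₁ z v, fderiv ℝ F₂ z v] := by
  have h := rot.hasFDerivAt.comp z (h₂.hasFDerivAt.neg.prodMk h₁.hasFDerivAt)
  have h' : HasFDerivAt (fun z => (!₂[F₁ z, F₂ z] : Plane)) _ z :=
    h.congr_of_eventuallyEq (Filter.Eventually.of_forall fun z => by simp)
  rw [h'.fderiv]
  simp

lemma fderiv_eq_tangent (g : ℝ × ℝ → ℝ) (z v : ℝ × ℝ) :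
    fderiv ℝ g z v = v.2 * (tangent g z).1 - v.1 * (tangent g z).2 := by
  have : v = v.1 • ((1, 0) : ℝ × ℝ) + v.2 • ((0, 1) : ℝ × ℝ) := by ext <;> simp
  conv_lhs => rw [this]
  simp only [map_add, map_smul, tangent, smul_eq_mul]
  ring

lemma continuous_tangent {g : ℝ × ℝ → ℝ} (hg : ContDiff ℝ ∞ g) : Continuous (tangent g) :=
  ((hg.continuous_fderiv (by simp)).clm_apply continuous_const).prodMk
    ((hg.continuous_fderiv (by simp)).clm_apply continuous_const).neg

/-- At the two ends of the strip the pattern consists of vertical lines. -/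
lemma IsBetween.eq_lines (hP : IsBetween P T L L') {p : ℝ × ℝ} (hp : p.2 ≤ 0 ∨ T ≤ p.2) :
    ∃ K, IsConfig K ∧ ∀ᶠ z in 𝓝 p, P z = lines R K z := by
  have hc : Continuous fun z : ℝ × ℝ => z.2 := continuous_snd
  rcases hp with hp | hp
  · refine ⟨L, hP.config_low, ?_⟩
    have h1 : p.2 < 1 := by linarith
    filter_upwards [(isOpen_lt hc continuous_const).mem_nhds h1] with z hz using hP.low z hz
  · refine ⟨L', hP.config_high, ?_⟩
    have h1 : T - 1 < p.2 := by linarith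
    filter_upwards [(isOpen_lt continuous_const hc).mem_nhds h1] with z hz using hP.high z hz

/-- Near both ends the pattern consists of lines, which contain no vertices. -/
lemma IsBetween.vertex_mem_Ioo (hP : IsBetween P T L L') {p : ℝ × ℝ} {u : R × Bool}
    (h : P p = .vertex u) : p.2 ∈ Ioo 0 T := by
  by_contra h'
  have h2 : p.2 ≤ 0 ∨ T ≤ p.2 := by
    by_contra! h3; exact h' h3
  obtain ⟨K, -, hK⟩ := hP.eq_lines h2
  exact lines_ne_vertex p u (hK.self_of_nhds.symm.trans h)

/-! ### From the strip to the cylinder. -/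

variable [hT : Fact (0 < T)]

lemma mark_cover {p : ℝ × ℝ} (hp : p.1 ∈ Ioc (-Real.pi) Real.pi) (hs : p ∈ strip T) :
    mark P (cover p : Cyl T) = P p := by
  rw [cover_eq hs, mark, Circle.arg_exp hp.1 hp.2]

lemma exists_cover (q : Cyl T) : ∃ p ∈ strip T, q = cover p ∧ p.1 ∈ Ioc (-Real.pi) Real.pi ∧
    p.2 = q.2 ∧ mark P q = P p :=
  ⟨(Complex.arg q.1, q.2), by simp, (cover_surj q).symm, Complex.arg_mem_Ioc _, rfl, rfl⟩

lemma exists_side {p : ℝ × ℝ} (hp : p ∈ strip T) : ∃ σ, crd T σ p 0 < T := by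
  by_cases h : p.2 < T
  · exact ⟨true, by rw [crd_zero]; exact h⟩
  · refine ⟨false, ?_⟩
    have h1 := hT.out
    have h2 := hp.2
    rw [crd_zero]
    simp only [Bool.false_eq_true, if_false]
    linarith

/-- Local statements descend from the strip: a neighbourhood of `p` in the strip covers the domain
of a chart around `q`. -/
lemma eventually_of_cover {q : Cyl T} {p : ℝ × ℝ} (hp : p ∈ strip T) (hq : q = cover p)
    {C : Cyl T → Prop} (h : ∀ᶠ z in 𝓝 p, z ∈ strip T → C (cover z)) : ∀ᶠ q' in 𝓝 q, C q' := by
  obtain ⟨σ, hσ⟩ := exists_side hp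
  obtain ⟨e, he, hqe⟩ := exists_isLocalForm_crd σ hp hσ h
  rw [← hq] at hqe
  filter_upwards [e.open_source.mem_nhds hqe] with q' hq'
  obtain ⟨z, hz, rfl, -⟩ := he.rep q' hq'
  exact hz.1 hz.2

namespace IsBetween

/-- Walls and vertices satisfy `|x| < π`, an open condition under which the principal argument
recovers `x`. -/
lemma eventually_mark (hP : IsBetween P T L L') {p : ℝ × ℝ} (h : P p ≠ .region) :
    ∀ᶠ z in 𝓝 p, z ∈ strip T → mark P (cover z : Cyl T) = P z := by
  have h1 : |p.1| < Real.pi := by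
    by_contra h'; exact h (hP.outside p (not_lt.1 h'))
  have hc : Continuous fun z : ℝ × ℝ => |z.1| := continuous_fst.abs
  filter_upwards [(isOpen_lt hc continuous_const).mem_nhds h1] with z hz hs
  have hz' := abs_lt.1 (show |z.1| < Real.pi from hz)
  exact mark_cover ⟨hz'.1, hz'.2.le⟩ hs

end IsBetween

end Pattern

/-! ### Local structure on the cylinder: regions, walls and vertices. -/

namespace Pattern

open Cyl

variable {B : Type*} {R : Set (List (B × Bool))} {P : Pattern R} {T : ℝ}
  {L L' : List (ℝ × (B × Bool))} [hT : Fact (0 < T)]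

namespace IsBetween

/-- Regions are open, also across the distinguished line. -/
lemma eventually_region (hP : IsBetween P T L L') {p : ℝ × ℝ} (hs : p ∈ strip T)
    (hp : p.1 ∈ Ioc (-Real.pi) Real.pi) (h : P p = .region) :
    ∀ᶠ q' in 𝓝 (cover p : Cyl T), mark P q' = .region := by
  refine eventually_of_cover hs rfl ?_
  have h1 := (hP.good p).eventually_region h
  have hc : Continuous fun z : ℝ × ℝ => z.1 := continuous_fst
  rcases hp.2.lt_or_eq with hlt | heq
  · filter_upwards [h1, (isOpen_lt continuous_const hc).mem_nhds hp.1,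
      (isOpen_lt hc continuous_const).mem_nhds hlt] with z hz hz1 hz2 hs
    have hz1 : -Real.pi < z.1 := hz1
    have hz2 : z.1 < Real.pi := hz2
    rw [mark_cover ⟨hz1, hz2.le⟩ hs, hz]
  · have hpi := Real.pi_pos
    -- Here `p` lies on the cut. Points beyond it have principal argument near `-π`, so the pattern
    -- must also be known near the translate of `p`.
    have h2 : P (p - (2 * Real.pi, 0)) = .region := by
      refine hP.outside _ ?_
      rw [Prod.fst_sub, heq, show Real.pi - 2 * Real.pi = -Real.pi by ring, abs_neg]
      exact le_abs_self _
    have h3 := (hP.good _).eventually_region h2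
    have hc' : Filter.Tendsto (fun z : ℝ × ℝ => z - (2 * Real.pi, 0)) (𝓝 p)
        (𝓝 (p - (2 * Real.pi, 0))) := (continuous_id.sub continuous_const).tendsto p
    have h4 : 0 < p.1 := by rw [heq]; exact hpi
    have h5 : p.1 < 2 * Real.pi := by rw [heq]; linarith
    filter_upwards [h1, hc'.eventually h3, (isOpen_lt continuous_const hc).mem_nhds h4,
      (isOpen_lt hc continuous_const).mem_nhds h5] with z hz hz' hz1 hz2 hs
    have hz1 : 0 < z.1 := hz1
    have hz2 : z.1 < 2 * Real.pi := hz2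
    rcases le_or_gt z.1 Real.pi with h6 | h6
    · rw [mark_cover ⟨by linarith, h6⟩ hs, hz]
    · have h7 : Circle.exp (-(2 * Real.pi)) = 1 := by
        rw [Circle.exp_neg, Circle.exp_two_pi, inv_one]
      have h8 : z - (2 * Real.pi, 0) = z + (-(2 * Real.pi), 0) := by ext <;> simp [sub_eq_add_neg]
      rw [← cover_add h7, ← h8, mark_cover _ (by simpa using hs), hz']
      constructor <;> simp only [Prod.fst_sub] <;> linarith

/-- Near a point, the label is the same or the dimension is larger. -/
lemma eventually_label (hP : IsBetween P T L L') (q : Cyl T) :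
    ∀ᶠ q' in 𝓝 q, (mark P q').label = (mark P q).label ∨
      (mark P q).label.dim < (mark P q').label.dim := by
  obtain ⟨p, hs, rfl, hp, -, hm⟩ := exists_cover (P := P) q
  rw [hm]
  by_cases h : P p = .region
  · filter_upwards [hP.eventually_region hs hp h] with q' hq'
    exact Or.inl (by rw [hq', h])
  refine eventually_of_cover hs rfl ?_
  cases hP.good p with
  | region h' => exact absurd h'.self_of_nhds h
  | wall g b hg h0 h1 h' =>
    filter_upwards [h', hP.eventually_mark h] with z hz hz' hs'
    rw [hz' hs', hz, h'.self_of_nhds]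
    simp only [curve, if_pos h0]
    split_ifs
    · exact Or.inl rfl
    · exact Or.inr (by simp [Mark.label, StratumLabel.dim])
  | vertex u w a hu ha hp' h' =>
    filter_upwards [h', hP.eventually_mark h] with z hz hz' hs'
    rw [hz' hs', hp']
    by_cases hzp : z = p
    · exact Or.inl (by rw [hzp, hp'])
    · right
      rcases hz hzp with h2 | ⟨k, -, h2⟩
      · rw [h2.1]; simp [Mark.label, StratumLabel.dim]
      · rw [h2]; simp [Mark.label, StratumLabel.dim]

/-- At the two ends the walls are vertical and a chart of the atlas makes them horizontal. In the
interior, the defining function `g` is completed to a coordinate system, with `g` as second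
coordinate. -/
lemma exists_wall_chart (hP : IsBetween P T L L') (q : Cyl T) (hq : (mark P q).label.dim = 1) :
    ∃ (e : OpenPartialHomeomorph (Cyl T) HalfPlane) (x : B × Bool), IsOrientedChart e ∧
      q ∈ e.source ∧ ∀ q' ∈ e.source,
        ((e q').1 1 = (e q).1 1 → ∃ y, (mark P q').label = .wall y ∧
          ReadsAlong (inChart e q' (vec q' (mark P q').dir)) !₂[1, 0] y x) ∧
        ((e q').1 1 ≠ (e q).1 1 → (mark P q').label = .region PUnit.unit) := by
  obtain ⟨p, hs, rfl, hp, -, hm⟩ := exists_cover (P := P) q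
  rw [hm, Mark.dim_label_eq_one] at hq
  obtain ⟨b, v, hbv⟩ := hq
  have hne : P p ≠ .region := by rw [hbv]; simp
  have hmark := hP.eventually_mark hne
  by_cases hend : p.2 ≤ 0 ∨ T ≤ p.2
  · obtain ⟨K, hK, hKP⟩ := hP.eq_lines hend
    obtain ⟨σ, hσ⟩ := exists_side hs
    have hne' : lines R K p ≠ .region := by rwa [← hKP.self_of_nhds]
    obtain ⟨l, hl, hlp⟩ := exists_of_lines_ne hne'
    have hiso : ∀ᶠ z : ℝ × ℝ in 𝓝 p, lines R K z ≠ .region → z.1 = p.1 := by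
      have h1 : ∀ᶠ z : ℝ × ℝ in 𝓝 p, ∀ x ∈ K, x.1 ≠ p.1 → z.1 ≠ x.1 := by
        refine (Filter.eventually_all_finite (List.finite_toSet K)).2 fun x _ => ?_
        by_cases hx : x.1 = p.1
        · simp [hx]
        · filter_upwards [continuous_fst.continuousAt.eventually_ne (Ne.symm hx)] with z hz _ using hz
      filter_upwards [h1] with z hz hzne
      obtain ⟨x, hx, hxz⟩ := exists_of_lines_ne hzne
      by_contra h
      exact hz x hx (by rwa [hxz]) hxz.symm
    obtain ⟨e, he, hqe⟩ := exists_isLocalForm_crd σ hs hσ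
      (Filter.inter_mem (Filter.inter_mem hmark hKP) hiso)
    -- The point `z₀` covering `cover p` is not known to be `p` itself. But it lies on a wall, and
    -- near `p` all walls are on the vertical line through `p`.
    obtain ⟨z₀, ⟨⟨⟨hz1, hz2⟩, hz3⟩, hzs⟩, hzq, hze, -⟩ := he.rep _ hqe
    have hz0 : z₀.1 = p.1 := by
      refine hz3 ?_
      rw [← show P z₀ = lines R K z₀ from hz2, ← hz1 hzs, ← hzq, hm]
      exact hne
    -- The chart direction `(1, 0)` points up at the lower end and down at the upper end, so the
    -- letter read along it has the sign `sg σ * sg l.2.2`.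
    refine ⟨e, (l.2.1, decide (0 < sg σ * sg l.2.2)), he.oriented, hqe, fun q' hq' => ?_⟩
    obtain ⟨z, ⟨⟨⟨hz1', hz2'⟩, hz3'⟩, hzs'⟩, rfl, hze', hd⟩ := he.rep _ hq'
    have hv : mark P (cover z : Cyl T) = lines R K z := (hz1' hzs').trans hz2'
    have heq : (e (cover z)).1 1 = (e (cover p)).1 1 ↔ z.1 = p.1 := by
      rw [hze', hze, crd_one, crd_one, hz0, neg_inj, mul_right_inj' (sg_ne_zero σ)]
    rw [hv, heq, hd, Ne, heq]
    refine ⟨fun h => ?_, fun h => ?_⟩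
    · rw [lines_of_mem hK hl (h.trans hlp.symm)]
      refine ⟨_, rfl, ?_⟩
      have hdv : fderiv ℝ (crd T σ) z (0, sg l.2.2) = (sg σ * sg l.2.2) • (!₂[1, 0] : Plane) := by
        rw [(hasFDerivAt_crd σ z).fderiv]
        ext i; fin_cases i <;> simp
      simp only [Mark.dir, hdv]
      by_cases hpos : 0 < sg σ * sg l.2.2
      · exact Or.inl ⟨_, hpos, rfl, by simp [hpos]⟩
      · refine Or.inr ⟨_, lt_of_le_of_ne (not_lt.1 hpos)
          (mul_ne_zero (sg_ne_zero σ) (sg_ne_zero _)), rfl, by simp [Signed.inv, hpos]⟩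
    · have : lines R K z = .region := by
        by_contra h'; exact h (hz3' h')
      rw [this]; rfl
  · push Not at hend
    cases hP.good p with
    | region h' => exact absurd h'.self_of_nhds hne
    | vertex u w a hu ha hp' h' => rw [hp'] at hbv; simp at hbv
    | wall g b hg h0 h1 h' =>
      set u := tangent g p with hu
      have hu0 : 0 < u.1 * u.1 + u.2 * u.2 := by
        by_contra h
        have h2 : u.1 = 0 := by nlinarith [sq_nonneg u.1, sq_nonneg u.2]
        have h3 : u.2 = 0 := by nlinarith [sq_nonneg u.1, sq_nonneg u.2]
        refine h1 (ContinuousLinearMap.ext fun v => ?_)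
        rw [fderiv_eq_tangent, ← hu, h2, h3]
        simp
      -- The first coordinate grows along the tangent `u` at `p`, which makes the Jacobian
      -- determinant of `(F, g)` at `p` equal to `|u|²`. The summand `1` puts the image of `p` into
      -- the open half-plane.
      set F : ℝ × ℝ → ℝ := fun z => u.1 * (z.1 - p.1) + u.2 * (z.2 - p.2) + 1 with hF
      have hFs : ContDiff ℝ ∞ F :=
        ((contDiff_const.mul (contDiff_fst.sub contDiff_const)).add
          (contDiff_const.mul (contDiff_snd.sub contDiff_const))).add contDiff_const
      have hFd : ∀ z v, fderiv ℝ F z v = u.1 * v.1 + u.2 * v.2 := fun z v => by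
        have : HasFDerivAt F
            (u.1 • ContinuousLinearMap.fst ℝ ℝ ℝ + u.2 • ContinuousLinearMap.snd ℝ ℝ ℝ) z :=
          (((hasFDerivAt_fst.sub_const _).const_mul u.1).add
            ((hasFDerivAt_snd.sub_const _).const_mul u.2)).add_const 1
        rw [this.fderiv]; simp
      have hΨd : ∀ z v, fderiv ℝ (fun z => (!₂[F z, g z] : Plane)) z v =
          !₂[u.1 * v.1 + u.2 * v.2, v.2 * (tangent g z).1 - v.1 * (tangent g z).2] := fun z v => by
        rw [fderiv_pair (hFs.differentiable (by simp) z) (hg.differentiable (by simp) z), hFd,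
          fderiv_eq_tangent g]
      -- This is the first component of the wall's direction in the new chart; its positivity keeps
      -- the reading of the label constant along the wall.
      have hpos : ∀ᶠ z in 𝓝 p, 0 < u.1 * (tangent g z).1 + u.2 * (tangent g z).2 := by
        have hc := continuous_tangent hg
        have hc' : Continuous fun z => u.1 * (tangent g z).1 + u.2 * (tangent g z).2 :=
          (continuous_const.mul hc.fst).add (continuous_const.mul hc.snd)
        exact (isOpen_lt continuous_const hc').mem_nhds hu0
      obtain ⟨e, he, hqe⟩ := exists_isLocalForm hend (contDiff_pair hFs hg) (by simp [hF])
        (by rw [hΨd, hΨd, ← hu]; simpa [cross] using hu0)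
        (Filter.inter_mem (Filter.inter_mem hmark h') hpos)
      obtain ⟨z₀, ⟨⟨⟨hz1, hz2⟩, -⟩, hzs⟩, hzq, hze, -⟩ := he.rep _ hqe
      have hz0 : g z₀ = 0 := by
        by_contra h
        have h2 : P z₀ = .region := hz2.trans (if_neg h)
        rw [← hz1 hzs, ← hzq, hm] at h2
        exact hne h2
      refine ⟨e, (b, true), he.oriented, hqe, fun q' hq' => ?_⟩
      obtain ⟨z, ⟨⟨⟨hz1', hz2'⟩, hz3'⟩, hzs'⟩, rfl, hze', hd⟩ := he.rep _ hq'
      have hv : mark P (cover z : Cyl T) = curve R g b z := (hz1' hzs').trans hz2'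
      have heq : (e (cover z)).1 1 = (e (cover p)).1 1 ↔ g z = 0 := by
        rw [hze', hze]; simp [hz0]
      rw [hv, heq, hd, Ne, heq]
      refine ⟨fun h => ?_, fun h => ?_⟩
      · simp only [curve, if_pos h]
        refine ⟨_, rfl, Or.inl ⟨_, hz3', ?_, rfl⟩⟩
        simp only [Mark.dir, hΨd]
        ext i; fin_cases i <;> simp; ring
      · simp only [curve, if_neg h]; rfl

end IsBetween

/-- The ray with `x = a t` has angle `π / 2 - arctan a`, which lies in `(0, π)` and increases as `a`
decreases. -/
lemma onRay_iff {p z : ℝ × ℝ} {a : ℝ} : OnRay p a z ↔ ∃ r : ℝ, 0 < r ∧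
    (!₂[z.1 - p.1 + 1, z.2] : Plane) = !₂[1, p.2] +
      r • !₂[Real.cos (Real.pi / 2 - Real.arctan a), Real.sin (Real.pi / 2 - Real.arctan a)] := by
  rw [Real.cos_pi_div_two_sub, Real.sin_pi_div_two_sub, Real.sin_arctan, Real.cos_arctan]
  have hs : 0 < √(1 + a ^ 2) := Real.sqrt_pos.2 (by positivity)
  have hext : ∀ r : ℝ, (!₂[z.1 - p.1 + 1, z.2] : Plane) = !₂[1, p.2] +
      r • !₂[a / √(1 + a ^ 2), 1 / √(1 + a ^ 2)] ↔
      z.1 - p.1 = r * (a / √(1 + a ^ 2)) ∧ z.2 = p.2 + r * (1 / √(1 + a ^ 2)) := fun r => by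
    constructor
    · intro h
      have h0 := congrArg (fun y : Plane => y 0) h
      have h1 := congrArg (fun y : Plane => y 1) h
      simp at h0 h1
      constructor
      · linarith
      · simpa using h1
    · rintro ⟨h0, h1⟩
      ext i; fin_cases i
      · simp [h0]; ring
      · simpa using h1
  simp only [hext]
  constructor
  · rintro ⟨h1, h2⟩
    refine ⟨(z.2 - p.2) * √(1 + a ^ 2), mul_pos (sub_pos.2 h1) hs, ?_, ?_⟩
    · rw [h2]; field_simp
    · field_simp; ring
  · rintro ⟨r, hr, h1, h2⟩
    have h3 : 0 < r * (1 / √(1 + a ^ 2)) := by positivity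
    refine ⟨by linarith, ?_⟩
    rw [h1, h2]; ring

lemma isOrientedChart_restr {e : OpenPartialHomeomorph (Cyl T) HalfPlane} (he : IsOrientedChart e)
    {s : Set (Cyl T)} (hs : IsOpen s) : IsOrientedChart (e.restr s) :=
  ⟨restr_mem_maximalAtlas _ he.1 hs, fun f hf q hq => he.2 f hf q ⟨hq.1.1, hq.2⟩⟩

/-- The branches are already straight rays near the vertex, so a horizontal translation of the
coordinates `(x, t)` suffices; it is smooth even at the vertex. The height remains positive since
vertices are interior. -/
lemma IsBetween.exists_vertex_chart (hP : IsBetween P T L L') (q : Cyl T) (u : R × Bool)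
    (hq : mark P q = .vertex u) :
    ∃ (h : OpenPartialHomeomorph (Cyl T) HalfPlane) (w : List (B × Bool)) (θ : Fin w.length → ℝ),
      q ∈ h.source ∧ IsOrientedChart (h.restr {q}ᶜ) ∧
      (presentationDefectData R).ψ₀₁ u = (w : Cycle (B × Bool)) ∧
      StrictMono θ ∧ (∀ k, θ k ∈ Ico 0 (2 * Real.pi)) ∧
      ∀ q' ∈ h.source, q' ≠ q →
        (((mark P q').label.dim = 1 ↔ ∃ k, ∃ r : ℝ, 0 < r ∧
          (h q').1 = (h q).1 + r • !₂[Real.cos (θ k), Real.sin (θ k)]) ∧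
        ((mark P q').label.dim ≠ 1 → (mark P q').label.dim = 2) ∧
        ∀ k, ∀ r : ℝ, 0 < r → (h q').1 = (h q).1 + r • !₂[Real.cos (θ k), Real.sin (θ k)] →
          ∃ y, (mark P q').label = .wall y ∧
            ReadsAlong (inChart h q' (vec q' (mark P q').dir))
              (-!₂[Real.cos (θ k), Real.sin (θ k)]) y (w.get k)) := by
  obtain ⟨p, hs, rfl, hp, -, hm⟩ := exists_cover (P := P) q
  rw [hm] at hq
  have hne : P p ≠ .region := by rw [hq]; simp
  have hmark := hP.eventually_mark hne
  have hIoo := hP.vertex_mem_Ioo hq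
  cases hP.good p with
  | region h' => exact absurd h'.self_of_nhds hne
  | wall g b hg h0 h1 h' =>
    have h2 := h'.self_of_nhds
    rw [curve, if_pos h0, hq] at h2
    simp at h2
  | vertex u' w a hu ha hp' h' =>
    obtain rfl : u' = u := by
      rw [hq] at hp'; simpa using hp'.symm
    set F : ℝ × ℝ → ℝ := fun z => z.1 - p.1 + 1 with hF
    have hFs : ContDiff ℝ ∞ F := (contDiff_fst.sub contDiff_const).add contDiff_const
    have hΨd : ∀ z v, fderiv ℝ (fun z : ℝ × ℝ => (!₂[F z, z.2] : Plane)) z v = !₂[v.1, v.2] :=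
      fun z v => by
        have h2 : HasFDerivAt F (ContinuousLinearMap.fst ℝ ℝ ℝ) z :=
          (hasFDerivAt_fst.sub_const _).add_const 1
        rw [fderiv_pair h2.differentiableAt differentiableAt_snd, h2.fderiv, fderiv_snd]
        rfl
    obtain ⟨e, he, hqe⟩ := exists_isLocalForm hIoo (contDiff_pair hFs contDiff_snd)
      (by simp [hF]) (by rw [hΨd, hΨd]; simp [cross]) (Filter.inter_mem hmark h')
    obtain ⟨z₀, ⟨⟨hz1, hz2⟩, hzs⟩, hzq, hze, -⟩ := he.rep _ hqe
    -- The pattern has a vertex at `z₀`, and near `p` the only vertex is `p`.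
    have hz0 : z₀ = p := by
      by_contra h
      have h2 : P z₀ = .vertex u' := by rw [← hz1 hzs, ← hzq, hm, hq]
      rcases hz2 h with h3 | ⟨k, -, h3⟩
      · rw [h2] at h3; simpa using h3.1
      · rw [h2] at h3; simp at h3
    have hep : (e (cover p)).1 = !₂[1, p.2] := by
      rw [hze, hz0]; simp [hF]
    have hpi := Real.pi_pos
    refine ⟨e, w, fun k => Real.pi / 2 - Real.arctan (a k), hqe,
      isOrientedChart_restr he.oriented isOpen_compl_singleton, hu, ?_, ?_, ?_⟩
    · intro i j hij
      have := Real.arctan_strictMono (ha hij)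
      simp only; linarith
    · intro k
      have h1 := Real.arctan_lt_pi_div_two (a k)
      have h2 := Real.neg_pi_div_two_lt_arctan (a k)
      constructor <;> linarith
    · intro q' hq' hne'
      obtain ⟨z, ⟨⟨hz1', hz2'⟩, hzs'⟩, rfl, hze', hd⟩ := he.rep _ hq'
      have hv : mark P (cover z : Cyl T) = P z := hz1' hzs'
      have hzp : z ≠ p := fun h => hne' (by rw [h])
      have hray : ∀ k, OnRay p (a k) z → P z =
          .wall (w.get k).1 (-sg (w.get k).2 * a k, -sg (w.get k).2) := fun k hk => by
        rcases hz2' hzp with h2 | ⟨k', hk', h2⟩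
        · exact absurd hk (h2.2 k)
        · have h3 : a k' * (z.2 - p.2) = a k * (z.2 - p.2) := hk'.2.symm.trans hk.2
          have h4 : k' = k := ha.injective (mul_right_cancel₀ (sub_pos.2 hk.1).ne' h3)
          rwa [h4] at h2
      have hon : ∀ k, (∃ r : ℝ, 0 < r ∧ (e (cover z)).1 = (e (cover p)).1 + r •
          !₂[Real.cos (Real.pi / 2 - Real.arctan (a k)),
            Real.sin (Real.pi / 2 - Real.arctan (a k))]) ↔ OnRay p (a k) z := fun k => by
        rw [hze', hep, onRay_iff]
      simp only [hon, hv]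
      refine ⟨⟨fun h => ?_, fun ⟨k, hk⟩ => ?_⟩, fun h => ?_, fun k r hr h => ?_⟩
      · obtain ⟨b, v, hbv⟩ := Mark.dim_label_eq_one.1 h
        rcases hz2' hzp with h2 | ⟨k, hk, -⟩
        · rw [h2.1] at hbv; simp at hbv
        · exact ⟨k, hk⟩
      · exact Mark.dim_label_eq_one.2 ⟨_, _, hray k hk⟩
      · rcases hz2' hzp with h2 | ⟨k, hk, h2⟩
        · exact Mark.dim_label_eq_two.2 h2.1
        · exact absurd (Mark.dim_label_eq_one.2 ⟨_, _, h2⟩) h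
      · have hk := (hon k).1 ⟨r, hr, h⟩
        rw [hd, hray k hk]
        refine ⟨_, rfl, ?_⟩
        simp only [Mark.dir, hΨd]
        rw [Real.cos_pi_div_two_sub, Real.sin_pi_div_two_sub, Real.sin_arctan, Real.cos_arctan]
        have hsq : 0 < √(1 + a k ^ 2) := Real.sqrt_pos.2 (by positivity)
        have hdv : (!₂[-sg (w.get k).2 * a k, -sg (w.get k).2] : Plane) =
            (sg (w.get k).2 * √(1 + a k ^ 2)) •
              -!₂[a k / √(1 + a k ^ 2), 1 / √(1 + a k ^ 2)] := by
          ext i; fin_cases i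
          · simp; field_simp
          · simp; field_simp
        rw [hdv]
        generalize w.get k = l
        obtain ⟨b, ε⟩ := l
        cases ε
        · exact Or.inr ⟨_, by simp [sg, hsq], rfl, rfl⟩
        · exact Or.inl ⟨_, by simp [sg, hsq], rfl, rfl⟩

end Pattern

/-! ### The defect structure of a pattern and its collars. -/

namespace Pattern

open Cyl

variable {B : Type*} {R : Set (List (B × Bool))} {P : Pattern R} {T : ℝ}
  {L L' : List (ℝ × (B × Bool))}

lemma mark_base (hP : IsBetween P T L L') {b : Cyl T} (hb : b ∈ baseLine T) :
    mark P b = .region := by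
  refine hP.outside _ ?_
  have h1 : Complex.arg b.1 = Real.pi := by
    rw [show b.1 = _ from hb, Circle.arg_exp (by linarith [Real.pi_pos]) le_rfl]
  rw [h1]
  exact le_abs_self _

section

variable [hT : Fact (0 < T)]

/-- The surface with defects of a pattern. -/
noncomputable def IsBetween.defects (hP : IsBetween P T L L') :
    DefectStructure (Cyl T) (presentationDefectData R) where
  d q := (mark P q).label
  dir q := vec q (mark P q).dir
  closed_zero := by
    rw [← isOpen_compl_iff, isOpen_iff_mem_nhds]
    intro q hq
    filter_upwards [hP.eventually_label q] with q' hq'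
    simp only [mem_compl_iff, mem_ofPred_eq] at hq ⊢
    rcases hq' with h | h
    · rwa [h]
    · omega
  closed_one := by
    rw [← isOpen_compl_iff, isOpen_iff_mem_nhds]
    intro q hq
    filter_upwards [hP.eventually_label q] with q' hq'
    simp only [mem_compl_iff, mem_ofPred_eq] at hq ⊢
    rcases hq' with h | h
    · rwa [h]
    · omega
  const_on_strata q q' hq' := by
    -- With discrete labels, `eventually_label` makes the label continuous on the stratum of a fixed
    -- dimension, hence constant on preconnected subsets.
    let _ : TopologicalSpace (StratumLabel (presentationDefectData R)) := ⊥
    have : DiscreteTopology (StratumLabel (presentationDefectData R)) := ⟨rfl⟩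
    have hc : ContinuousOn (fun q : Cyl T => (mark P q).label)
        {q' | (mark P q').label.dim = (mark P q).label.dim} := by
      intro x hx
      have h1 : ∀ᶠ y in 𝓝[{q' | (mark P q').label.dim = (mark P q).label.dim}] x,
          (mark P y).label = (mark P x).label := by
        filter_upwards [nhdsWithin_le_nhds (hP.eventually_label x), self_mem_nhdsWithin]
          with y hy hy'
        refine hy.resolve_right fun h => ?_
        rw [show (mark P y).label.dim = _ from hy', show (mark P x).label.dim = _ from hx] at h
        exact lt_irrefl _ h
      exact (continuousWithinAt_const (b := (mark P x).label)).congr_of_eventuallyEq h1 rfl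
    exact isPreconnected_connectedComponentIn.constant
      (hc.mono (connectedComponentIn_subset _ _)) hq' (mem_connectedComponentIn rfl)
  wall_chart q hq := by
    obtain ⟨e, x, he, hqe, h⟩ := hP.exists_wall_chart q hq
    exact ⟨e, x, he, hqe, fun q' hq' => ⟨(h q' hq').1, fun h' => (h q' hq').2 h'.ne',
      fun h' => (h q' hq').2 h'.ne⟩⟩
  vertex_interior q hq := by
    obtain ⟨u, hu⟩ := Mark.dim_label_eq_zero.1 hq
    have := hP.vertex_mem_Ioo hu
    exact isInteriorPoint this.1 this.2
  vertex_chart q u hq := by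
    refine hP.exists_vertex_chart q u ?_
    cases h : mark P q <;> rw [h] at hq <;> simp [Mark.label] at hq
    rw [hq]

/-- The configuration of the marked points of a circle with defects. -/
def Matches (U : DefectCircle (presentationDefectData R)) (L : List (ℝ × (B × Bool))) : Prop :=
  ∀ z, (∀ l, U.d z = Sum.inl l → (Complex.arg z, l) ∈ L) ∧
    ∀ a, U.d z = Sum.inr a → ∀ x ∈ L, x.1 ≠ Complex.arg z

end

lemma exists_matches {U : DefectCircle (presentationDefectData R)} {w : List (B × Bool)}
    (hU : U.Represents w) :
    ∃ L, IsConfig L ∧ L.map Prod.snd = w ∧ Matches U L := by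
  obtain ⟨θ, hθ, hm, hr, hl⟩ := hU
  have harg : ∀ k, Complex.arg (Circle.exp (θ k)) = θ k := fun k =>
    Circle.arg_exp (hm k).1 (hm k).2.le
  refine ⟨List.ofFn fun k => (θ k, w.get k), ⟨?_, ?_⟩, ?_, fun z => ⟨fun l hz => ?_, ?_⟩⟩
  · exact List.pairwise_ofFn.2 fun i j hij => hθ hij
  · intro x hx
    obtain ⟨k, rfl⟩ := List.mem_ofFn.1 hx
    exact hm k
  · rw [List.map_ofFn]
    exact List.ofFn_get w
  · have h1 : z ∈ range fun k => Circle.exp (θ k) := by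
      rw [← hr]; simp [hz]
    obtain ⟨k, rfl⟩ := h1
    have h2 : l = w.get k := by
      have := (hl k).symm.trans hz
      simpa using this.symm
    refine List.mem_ofFn.2 ⟨k, ?_⟩
    rw [harg, h2]
  · intro a hz x hx hxz
    obtain ⟨k, rfl⟩ := List.mem_ofFn.1 hx
    have h1 : z = Circle.exp (θ k) := by rw [← Circle.exp_arg z, ← hxz]
    rw [h1, hl k] at hz
    simp at hz

variable [hT : Fact (0 < T)]

/-- The inclusion of a part of the cylinder, on which the pattern consists of vertical lines. -/
noncomputable def IsBetween.cylinder (hP : IsBetween P T L L')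
    {U : DefectCircle (presentationDefectData R)} {K : List (ℝ × (B × Bool))} (hK : IsConfig K)
    (hU : Matches U K) (σ : Bool) (c : ℝ) {J : Set ℝ}
    (hJ : ∀ t ∈ J, c + t ∈ Icc 0 T ∧ crd T σ (0, c + t) 0 < T ∧ ∀ x, P (x, c + t) = lines R K (x, c + t))
    (hJo : IsOpen {t : Icc (0 : ℝ) T | (t : ℝ) - c ∈ J}) (hJd : UniqueDiffOn ℝ J) :
    DefectCylinder hP.defects [U] J where
  toFun _ z t := (z, projIcc 0 T hT.out.le (c + t))
  isOpenEmbedding := by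
    have h1 : Topology.IsOpenEmbedding fun t : J => projIcc 0 T hT.out.le (c + t) := by
      have hcont : Continuous fun t : J => projIcc 0 T hT.out.le (c + t) :=
        continuous_projIcc.comp (continuous_const.add continuous_subtype_val)
      refine ⟨Topology.IsEmbedding.of_comp hcont continuous_subtype_val ?_, ?_⟩
      · have h2 : (Subtype.val ∘ fun t : J => projIcc 0 T hT.out.le (c + t)) =
            (Homeomorph.addLeft c) ∘ Subtype.val := by
          funext t
          simp [projIcc_of_mem _ (hJ t t.2).1]
        rw [h2]
        exact (Homeomorph.addLeft c).isEmbedding.comp Topology.IsEmbedding.subtypeVal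
      · convert hJo using 1
        ext t
        constructor
        · rintro ⟨s, rfl⟩
          simp [projIcc_of_mem _ (hJ s s.2).1]
        · intro h
          refine ⟨⟨_, h⟩, ?_⟩
          simp
    have : Unique (Fin [U].length) := inferInstanceAs (Unique (Fin 1))
    exact (Topology.IsOpenEmbedding.id.prodMap h1).comp
      ((Homeomorph.uniqueProd (Fin [U].length) Circle).prodCongr
        (Homeomorph.refl J)).isOpenEmbedding
  local_iso i θ t ht := by
    obtain ⟨hc, hσ, hl⟩ := hJ t ht
    have hp : (θ, c + t) ∈ strip T := mem_strip.2 hc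
    have he : IsOrientedChart (chart (branch θ) (branch_eq θ) σ : OpenPartialHomeomorph (Cyl T) _) :=
      ⟨IsManifold.subset_maximalAtlas (chart_mem_atlas' _ _ _),
        OrientedSurface.oriented _ (chart_mem_atlas' _ _ _)⟩
    have hcover : (Circle.exp θ, projIcc 0 T hT.out.le (c + t)) = (cover (θ, c + t) : Cyl T) := rfl
    have hmem : (Circle.exp θ, projIcc 0 T hT.out.le (c + t)) ∈
        (chart (branch θ) (branch_eq θ) σ : OpenPartialHomeomorph (Cyl T) _).source := by
      rw [Cyl.mem_chart_source, projIcc_of_mem _ hc]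
      exact ⟨exp_mem_branch θ, hσ⟩
    have hval : ∀ z ∈ strip T, z.1 ∈ (branch θ).source →
        (chart (branch θ) (branch_eq θ) σ (cover z : Cyl T)).1 = crd T σ z := fun z hz hz' => by
      rw [chart_val, cover_eq hz, ← branch_eq θ, (branch θ).left_inv hz']
    have hsrc := (branch θ).open_source.preimage (continuous_fst (X := ℝ) (Y := ℝ))
    have hvec := inChart_vec he hmem hp hcover ((contDiff_crd (T := T) σ).differentiable (by simp) _)
      (by
        filter_upwards [self_mem_nhdsWithin, nhdsWithin_le_nhds (hsrc.mem_nhds (mem_branch θ))]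
          with z hz hz' using hval z hz hz')
    set g : ℝ × ℝ → Plane := fun x => (chart (branch θ) (branch_eq θ) σ
      ((Circle.exp x.1, projIcc 0 T hT.out.le (c + x.2)) : Cyl T)).1 with hg
    -- The equality is claimed only within `univ ×ˢ J`: at a closed end of `J`, `projIcc` truncates
    -- on the other side.
    have hgeq : ∀ᶠ x in 𝓝[univ ×ˢ J] (θ, t), g x = crd T σ (x.1, c + x.2) := by
      filter_upwards [self_mem_nhdsWithin, nhdsWithin_le_nhds
        (hsrc.mem_nhds (show (θ, t) ∈ Prod.fst ⁻¹' (branch θ).source from mem_branch θ))]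
        with x hx hx'
      exact hval (x.1, c + x.2) (mem_strip.2 (hJ _ hx.2).1) hx'
    have hsm : ContDiff ℝ ∞ fun x : ℝ × ℝ => crd T σ (x.1, c + x.2) :=
      (contDiff_crd σ).comp (contDiff_fst.prodMk (contDiff_const.add contDiff_snd))
    have hmem' : (θ, t) ∈ (univ : Set ℝ) ×ˢ J := ⟨mem_univ _, ht⟩
    have hd : HasFDerivAt (fun x : ℝ × ℝ => crd T σ (x.1, c + x.2))
        (sg σ • (rot : (ℝ × ℝ) →L[ℝ] Plane)) (θ, t) := by
      have h1 : HasFDerivAt (fun x : ℝ × ℝ => (x.1, c + x.2)) (ContinuousLinearMap.id ℝ (ℝ × ℝ))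
          (θ, t) := by
        refine ((hasFDerivAt_id (𝕜 := ℝ) (θ, t)).const_add ((0, c) : ℝ × ℝ)).congr_of_eventuallyEq
          (Filter.Eventually.of_forall fun x => ?_)
        simp [Prod.ext_iff]
      exact (hasFDerivAt_crd σ (θ, c + t)).comp (θ, t) h1
    have hg' : fderivWithin ℝ g (univ ×ˢ J) (θ, t) = sg σ • (rot : (ℝ × ℝ) →L[ℝ] Plane) :=
      ((hd.hasFDerivWithinAt).congr_of_eventuallyEq hgeq
        (hgeq.self_of_nhdsWithin hmem')).fderivWithin
        ((uniqueDiffOn_univ.prod hJd) _ hmem')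
    have hmark : mark P (cover (θ, c + t) : Cyl T) =
        lines R K (Complex.arg (Circle.exp θ), c + t) := by
      rw [cover_eq hp, mark, hl]
    have hi : [U].get i = U := by
      have : Subsingleton (Fin [U].length) := inferInstanceAs (Subsingleton (Fin 1))
      rw [Subsingleton.elim i ⟨0, by simp⟩]; rfl
    refine ⟨_, g, fderivWithin ℝ g (univ ×ˢ J) (θ, t), he, hmem, rfl,
      hsm.contDiffAt.contDiffWithinAt.congr_of_eventuallyEq_of_mem hgeq hmem', rfl, ?_, ?_, ?_⟩
    · rw [hg']
      cases σ <;> simp [cross, sg]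
    · intro x hx
      rw [hi] at hx
      have hmark' := hmark.trans (lines_of_mem hK ((hU _).1 x hx) rfl)
      refine ⟨(x.1, true), ?_, ?_⟩
      · change (mark P (cover (θ, c + t) : Cyl T)).label = _
        rw [hmark']; rfl
      · change ReadsAlong (inChart _ _ (vec _ (mark P (cover (θ, c + t) : Cyl T)).dir)) _ _ _
        rw [hvec, hmark', hg', (hasFDerivAt_crd σ _).fderiv]
        -- The wall's direction is `sg x.2` times the upward direction, so reading upwards gives the
        -- positive letter or its inverse, as `x` prescribes.
        have h1 : (sg σ • (rot : (ℝ × ℝ) →L[ℝ] Plane)) (0, sg x.2) =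
            sg x.2 • (sg σ • (rot : (ℝ × ℝ) →L[ℝ] Plane)) (0, 1) := by
          rw [← map_smul]; simp
        simp only [Mark.dir]
        rw [h1]
        obtain ⟨b, ε⟩ := x
        cases ε
        · exact Or.inr ⟨_, by simp [sg], rfl, rfl⟩
        · exact Or.inl ⟨_, by simp [sg], rfl, rfl⟩
    · intro a ha
      rw [hi] at ha
      change (mark P (cover (θ, c + t) : Cyl T)).label = _
      rw [hmark, lines_eq_region fun x hx => (hU _).2 a ha x hx]
      rfl

end Pattern

/-! ### Assembly of the bordism. -/

open Pattern Cyl in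
/-- Circles with defects which are connected by a pattern are cobordant. -/
lemma Pattern.Connects.cobordant {B : Type*} {R : Set (List (B × Bool))}
    {L L' : List (ℝ × (B × Bool))} (h : Connects R L L') (hL : IsConfig L) (hL' : IsConfig L')
    {U V : DefectCircle (presentationDefectData R)} (hU : Matches U L) (hV : Matches V L') :
    DefectCobordant [U] [V] := by
  obtain ⟨P, T, hT1, hg, h0, h1, ho⟩ := h
  have hT : Fact (0 < T) := ⟨by linarith⟩
  have hP : IsBetween P T L L' := ⟨hg, h0, h1, ho, hL, hL'⟩
  have hin : ∀ t ∈ Ico (0 : ℝ) 1, (0 : ℝ) + t ∈ Icc 0 T ∧ crd T true (0, 0 + t) 0 < T ∧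
      ∀ x, P (x, 0 + t) = lines R L (x, 0 + t) := fun t ht => by
    refine ⟨⟨by linarith [ht.1], by linarith [ht.2]⟩, ?_, fun x => h0 _ (by simpa using ht.2)⟩
    rw [crd_zero]
    simp only [if_true]
    linarith [ht.2]
  have hout : ∀ t ∈ Ioc (-1 : ℝ) 0, T + t ∈ Icc 0 T ∧ crd T false (0, T + t) 0 < T ∧
      ∀ x, P (x, T + t) = lines R L' (x, T + t) := fun t ht => by
    refine ⟨⟨by linarith [ht.1], by linarith [ht.2]⟩, ?_, fun x => h1 _ (by linarith [ht.1])⟩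
    rw [crd_zero]
    simp only [Bool.false_eq_true, if_false]
    linarith [ht.1]
  have hino : IsOpen {t : Icc (0 : ℝ) T | (t : ℝ) - 0 ∈ Ico (0 : ℝ) 1} := by
    have : {t : Icc (0 : ℝ) T | (t : ℝ) - 0 ∈ Ico (0 : ℝ) 1} =
        {t : Icc (0 : ℝ) T | (t : ℝ) < 1} := by
      ext t
      simp only [sub_zero, mem_Ico, mem_ofPred_eq, and_iff_right t.2.1]
    rw [this]
    exact isOpen_lt continuous_subtype_val continuous_const
  have houto : IsOpen {t : Icc (0 : ℝ) T | (t : ℝ) - T ∈ Ioc (-1 : ℝ) 0} := by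
    have : {t : Icc (0 : ℝ) T | (t : ℝ) - T ∈ Ioc (-1 : ℝ) 0} =
        {t : Icc (0 : ℝ) T | T - 1 < (t : ℝ)} := by
      ext t
      have := t.2.2
      simp only [mem_Ioc, mem_ofPred_eq]
      constructor
      · rintro ⟨h, -⟩; linarith
      · intro h; constructor <;> linarith
    rw [this]
    exact isOpen_lt continuous_const continuous_subtype_val
  -- The collars are the parts `0 ≤ t < 1` and `T - 1 < t ≤ T`, where the pattern is a row of lines.
  -- They may overlap; only their cores have to be disjoint.
  let cin := hP.cylinder hL hU true 0 hin hino (uniqueDiffOn_Ico 0 1)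
  let cout := hP.cylinder hL' hV false T hout houto (uniqueDiffOn_Ioc (-1) 0)
  have hcin : cin.core = {q | (q.2 : ℝ) = 0} := by
    ext q
    constructor
    · rintro ⟨i, z, rfl⟩
      change (projIcc 0 T hT.out.le (0 + 0) : ℝ) = 0
      rw [add_zero, projIcc_left]
    · intro hq
      refine ⟨⟨0, by simp⟩, q.1, Prod.ext rfl (Subtype.ext ?_)⟩
      change (projIcc 0 T hT.out.le (0 + 0) : ℝ) = q.2
      rw [add_zero, projIcc_left, show (q.2 : ℝ) = 0 from hq]
  have hcout : cout.core = {q | (q.2 : ℝ) = T} := by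
    ext q
    constructor
    · rintro ⟨i, z, rfl⟩
      change (projIcc 0 T hT.out.le (T + 0) : ℝ) = T
      rw [add_zero, projIcc_right]
    · intro hq
      refine ⟨⟨0, by simp⟩, q.1, Prod.ext rfl (Subtype.ext ?_)⟩
      change (projIcc 0 T hT.out.le (T + 0) : ℝ) = q.2
      rw [add_zero, projIcc_right, show (q.2 : ℝ) = T from hq]
  exact ⟨{
    carrier := Cyl T
    defects := hP.defects
    inCollar := cin
    outCollar := cout
    disjoint := by
      rw [hcin, hcout, Set.disjoint_left]
      intro q hq hq'
      exact hT.out.ne (hq.symm.trans hq')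
    boundary_eq := by rw [hcin, hcout, Cyl.boundary_eq]; rfl
    height := height
    isHeight := isHeightFunction_height hcin hcout
    base := baseLine T
    base_in := fun i => rfl
    base_out := fun i => rfl
    base_generic := fun t _ _ q hq => existsUnique_base t q hq
    base_component := fun b hb => by
      have hsub : baseLine T ⊆ {q | (hP.defects.d q).dim = 2} := fun q hq =>
        Mark.dim_label_eq_two.2 (mark_base hP hq)
      exact ⟨hsub hb, isPreconnected_baseLine.subset_connectedComponentIn hb hsub⟩ }⟩

open Pattern in
theorem mainTheorem8 {G : Type*} [Group G] {B : Type*} (R : Set (List (B × Bool)))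
    (φ : PresentedGroup (FreeGroup.mk '' R) ≃* G)
    (w₁ w₂ : List (B × Bool))
    (hw : φ (PresentedGroup.mk _ (FreeGroup.mk w₁)) = φ (PresentedGroup.mk _ (FreeGroup.mk w₂)))
    (U V : DefectCircle (presentationDefectData R))
    (hU : U.Represents w₁) (hV : V.Represents w₂) :
    DefectCobordant [U] [V] := by
  obtain ⟨L, hL, rfl, hUL⟩ := exists_matches hU
  obtain ⟨L', hL', rfl, hVL⟩ := exists_matches hV
  exact (WordConnects.connects hL hL'
    (wordConnects_of_presentedGroup_eq (φ.injective hw))).cobordant hL hL' hUL hVL
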